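/- Let $\varepsilon>0$, $y_0\in(-1,0]$, $c_2>0$, and put $$\varepsilon_1=\frac{\varepsilon}{(1+y_0)^2},\qquad \varepsilon_2=\frac{\varepsilon}{(1-y_0)^2},\qquad a=\frac{1+y_0}{1-y_0},\qquad \mathcal T=\{(x,y)\in\mathbb R^2 : 0\le y\le x\le 1\}.$$ Let $\lambda_1,\lambda_2\in C^1([0,1])$. Let $k_{11}\in C^1(\mathcal T)$, and let $k_{12}\in C(\mathcal T)$ be such that its restrictions to $\{(x,y)\in\mathcal T:\sqrt{\varepsilon_1}\,y\le\sqrt{\varepsilon_2}\,x\}$ and to $\{(x,y)\in\mathcal T:\sqrt{\varepsilon_1}\,y\ge\sqrt{\varepsilon_2}\,x\}$ are of class $C^1$ (for instance, $k_{11},k_{12}\in C^2(\mathcal T)$). For functions $\hat k_{21},\hat k_{22},\check k_{21},\check k_{22}$ on $\mathcal T$ write $$k_{21}(x,y)=\frac1{2\sqrt{\varepsilon_2}}\int_y^x\bigl(\check k_{21}(z,y)+\hat k_{21}(z,y)\bigr)dz,$$ $$k_{22}(x,y)=-\int_0^y\frac{\lambda_2(z)+c_2}{2\varepsilon_2}\,dz+\frac1{2\sqrt{\varepsilon_2}}\int_y^x\bigl(\check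 k_{22}(z,y)+\hat k_{22}(z,y)\bigr)dz,$$ $$g[k_{21}](x)=\frac{\varepsilon_2-\varepsilon_1}{2\sqrt{\varepsilon_1}}\bigl(\check k_{21}(x,x)-\hat k_{21}(x,x)\bigr).$$ Consider the system, for $(x,y)\in\mathcal T$ and $i=1,2$, $$\sqrt{\varepsilon_2}\,\partial_x\hat k_{2i}+\sqrt{\varepsilon_i}\,\partial_y\hat k_{2i}=(\lambda_i(y)+c_2)\,k_{2i}-g[k_{21}](x)\,k_{1i},$$ $$\sqrt{\varepsilon_2}\,\partial_x\check k_{2i}-\sqrt{\varepsilon_i}\,\partial_y\check k_{2i}=(\lambda_i(y)+c_2)\,k_{2i}-g[k_{21}](x)\,k_{1i},$$ with the boundary conditions, for $x\in[0,1]$, $$\hat k_{21}(x,0)=-\frac{1-a^2}{1+a^2}\check k_{21}(x,0)+\frac{2a^3}{1+a^2}\check k_{22}(x,0),\qquad \hat k_{22}(x,0)=\frac{2}{a(1+a^2)}\check k_{21}(x,0)+\frac{1-a^2}{1+a^2}\check k_{22}(x,0),$$ $$\check k_{21}(x,x)=-\frac{\sqrt{\varepsilon_1}-\sqrt{\varepsilon_2}}{\sqrt{\varepsilon_1}+\sqrt{\varepsilon_2}}\,\hat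 k_{21}(x,x),\qquad \check k_{22}(x,x)=-\frac{\lambda_2(x)+c_2}{2\sqrt{\varepsilon_2}}.$$ This system has exactly one solution $(\hat k_{21},\hat k_{22},\check k_{21},\check k_{22})$ with all four components in $C^1(\mathcal T)$. For this solution, $k_{21},k_{22}\in C^2(\mathcal T)$, and on $\mathcal T$, for $i=1,2$, $$\hat k_{2i}=\sqrt{\varepsilon_2}\,\partial_xk_{2i}-\sqrt{\varepsilon_i}\,\partial_yk_{2i},\qquad \check k_{2i}=\sqrt{\varepsilon_2}\,\partial_xk_{2i}+\sqrt{\varepsilon_i}\,\partial_yk_{2i}.$$ -/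

import Mathlib

open Set

noncomputable section

namespace FoldedKernel

/-- Diffusion coefficient of the first folded state. -/
def eps1 (ε y₀ : ℝ) : ℝ := ε / (1 + y₀) ^ 2

/-- Diffusion coefficient of the second folded state. -/
def eps2 (ε y₀ : ℝ) : ℝ := ε / (1 - y₀) ^ 2

/-- The folding ratio. -/
def foldRatio (y₀ : ℝ) : ℝ := (1 + y₀) / (1 - y₀)

/-- The closed triangle `0 ≤ y ≤ x ≤ 1`; points are written `(x, y)`. -/
def triangle : Set (ℝ × ℝ) := {p | 0 ≤ p.2 ∧ p.2 ≤ p.1 ∧ p.1 ≤ 1}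

/-- The part of the triangle on or below the ray `√ε₁ y = √ε₂ x`. -/
def lowerPart (ε y₀ : ℝ) : Set (ℝ × ℝ) :=
  {p ∈ triangle | √(eps1 ε y₀) * p.2 ≤ √(eps2 ε y₀) * p.1}

/-- The part of the triangle on or above the ray `√ε₁ y = √ε₂ x`. -/
def upperPart (ε y₀ : ℝ) : Set (ℝ × ℝ) :=
  {p ∈ triangle | √(eps2 ε y₀) * p.1 ≤ √(eps1 ε y₀) * p.2}

/-- `∂ₓ f` on the closed triangle (one-sided on its boundary). -/
def dx (f : ℝ × ℝ → ℝ) (p : ℝ × ℝ) : ℝ := fderivWithin ℝ f triangle p (1, 0)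

/-- `∂_y f` on the closed triangle (one-sided on its boundary). -/
def dy (f : ℝ × ℝ → ℝ) (p : ℝ × ℝ) : ℝ := fderivWithin ℝ f triangle p (0, 1)

/-- The kernel `k₂₁` recovered from its Riemann invariants
`kh = √ε₂ ∂ₓ k₂₁ - √ε₁ ∂_y k₂₁` and `kc = √ε₂ ∂ₓ k₂₁ + √ε₁ ∂_y k₂₁`. -/
def k21Of (ε y₀ : ℝ) (kh kc : ℝ × ℝ → ℝ) (p : ℝ × ℝ) : ℝ :=
  1 / (2 * √(eps2 ε y₀)) * ∫ z in p.2..p.1, (kc (z, p.2) + kh (z, p.2))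

/-- The kernel `k₂₂` recovered from its Riemann invariants
`kh = √ε₂ ∂ₓ k₂₂ - √ε₂ ∂_y k₂₂` and `kc = √ε₂ ∂ₓ k₂₂ + √ε₂ ∂_y k₂₂`. -/
def k22Of (ε y₀ c₂ : ℝ) (lam₂ : ℝ → ℝ) (kh kc : ℝ × ℝ → ℝ) (p : ℝ × ℝ) : ℝ :=
  -(∫ z in (0 : ℝ)..p.2, (lam₂ z + c₂) / (2 * eps2 ε y₀)) +
    1 / (2 * √(eps2 ε y₀)) * ∫ z in p.2..p.1, (kc (z, p.2) + kh (z, p.2))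

/-- The trace coupling `g[k₂₁](x) = (ε₂ - ε₁) ∂_y k₂₁(x, x)` in terms of the Riemann invariants
of `k₂₁`. -/
def gTrace (ε y₀ : ℝ) (kh kc : ℝ × ℝ → ℝ) (x : ℝ) : ℝ :=
  (eps2 ε y₀ - eps1 ε y₀) / (2 * √(eps1 ε y₀)) * (kc (x, x) - kh (x, x))

/-- `(kh₂₁, kh₂₂, kc₂₁, kc₂₂)` is a `C¹` solution, on the closed triangle, of the second-row
kernel system with sources `k₁₁`, `k₁₂`. -/
structure IsSecondRowSolution (ε y₀ c₂ : ℝ) (lam₁ lam₂ : ℝ → ℝ) (k₁₁ k₁₂ : ℝ × ℝ → ℝ)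
    (kh₂₁ kh₂₂ kc₂₁ kc₂₂ : ℝ × ℝ → ℝ) : Prop where
  contDiff_kh₂₁ : ContDiffOn ℝ 1 kh₂₁ triangle
  contDiff_kh₂₂ : ContDiffOn ℝ 1 kh₂₂ triangle
  contDiff_kc₂₁ : ContDiffOn ℝ 1 kc₂₁ triangle
  contDiff_kc₂₂ : ContDiffOn ℝ 1 kc₂₂ triangle
  pde_kh₂₁ : ∀ p ∈ triangle,
    √(eps2 ε y₀) * dx kh₂₁ p + √(eps1 ε y₀) * dy kh₂₁ p =
      (lam₁ p.2 + c₂) * k21Of ε y₀ kh₂₁ kc₂₁ p - gTrace ε y₀ kh₂₁ kc₂₁ p.1 * k₁₁ p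
  pde_kh₂₂ : ∀ p ∈ triangle,
    √(eps2 ε y₀) * dx kh₂₂ p + √(eps2 ε y₀) * dy kh₂₂ p =
      (lam₂ p.2 + c₂) * k22Of ε y₀ c₂ lam₂ kh₂₂ kc₂₂ p - gTrace ε y₀ kh₂₁ kc₂₁ p.1 * k₁₂ p
  pde_kc₂₁ : ∀ p ∈ triangle,
    √(eps2 ε y₀) * dx kc₂₁ p - √(eps1 ε y₀) * dy kc₂₁ p =
      (lam₁ p.2 + c₂) * k21Of ε y₀ kh₂₁ kc₂₁ p - gTrace ε y₀ kh₂₁ kc₂₁ p.1 * k₁₁ p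
  pde_kc₂₂ : ∀ p ∈ triangle,
    √(eps2 ε y₀) * dx kc₂₂ p - √(eps2 ε y₀) * dy kc₂₂ p =
      (lam₂ p.2 + c₂) * k22Of ε y₀ c₂ lam₂ kh₂₂ kc₂₂ p - gTrace ε y₀ kh₂₁ kc₂₁ p.1 * k₁₂ p
  bc_kh₂₁ : ∀ x ∈ Icc (0 : ℝ) 1,
    kh₂₁ (x, 0) = -((1 - foldRatio y₀ ^ 2) / (1 + foldRatio y₀ ^ 2)) * kc₂₁ (x, 0)
      + 2 * foldRatio y₀ ^ 3 / (1 + foldRatio y₀ ^ 2) * kc₂₂ (x, 0)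
  bc_kh₂₂ : ∀ x ∈ Icc (0 : ℝ) 1,
    kh₂₂ (x, 0) = 2 / (foldRatio y₀ * (1 + foldRatio y₀ ^ 2)) * kc₂₁ (x, 0)
      + (1 - foldRatio y₀ ^ 2) / (1 + foldRatio y₀ ^ 2) * kc₂₂ (x, 0)
  bc_kc₂₁ : ∀ x ∈ Icc (0 : ℝ) 1,
    kc₂₁ (x, x) = -((√(eps1 ε y₀) - √(eps2 ε y₀)) / (√(eps1 ε y₀) + √(eps2 ε y₀))) * kh₂₁ (x, x)
  bc_kc₂₂ : ∀ x ∈ Icc (0 : ℝ) 1,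
    kc₂₂ (x, x) = -((lam₂ x + c₂) / (2 * √(eps2 ε y₀)))

end FoldedKernel

end

/-! Write `a` for the folding ratio and μ = √ε₂, so that √ε₁ = μ / a. In every equation x acts as
time: the hat components travel upwards from the axis with slopes 1 / a and 1, the check components
downwards from the diagonal with slopes -1 / a and -1. Integration along these lines turns the
system into a fixed-point equation for `Coefficients.picard`, and every classical solution yields a
continuous fixed point (`exists_fixedPoint_of_solution`).

Contraction (`exists_picard_contraction`). The sources at a point involve only values at abscissae
not exceeding its own, so the weight exp (κ x) makes the integral terms as small as desired for
large κ. The boundary terms gain nothing from κ. They contract because the reflection coefficients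
`q` and `r` are below one, while the couplings `t₁`, `t₂`, which need not be small, close no loop:
kh₂₂ enters no boundary condition and kc₂₂ is prescribed on the diagonal. Relative weights absorb
them. This gives one and only one continuous fixed point on the triangle.

Regularity (`exists_contDiff_of_picard_fixedPoint`). A line integral is C¹ once its source has a
y-derivative in the weak sense of `RegularAlong`; no x-derivative is needed. The trace coupling
depends on x alone, so continuity suffices for it. The kernels inside the sources are potentials of
an exact form built from the invariants (`exists_potential`), hence C¹ although the invariants are
so far only continuous. The kink of k₁₂ lies on the ray y = a x, which is transversal to the
characteristics of slope 1 and -1 if a < 1 and is the diagonal if a = 1. With regular sources kc₂₂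
is C¹ at once, the trace of kh₂₁ on the axis solves a dilation equation with C¹ datum
(`exists_contDiff_of_dilation_eq`), and the other components follow by substitution.

Once the invariants are C¹, the same potentials have C¹ gradient. This makes the kernels C², and
reading off the gradient recovers the invariants. -/

noncomputable section

namespace FoldedKernel

open MeasureTheory Filter Topology

/-! ### Differentiating integrals along parallel lines -/

/-- The linear form `u dx + v dy` on the plane. -/
def planeForm (u v : ℝ) : ℝ × ℝ →L[ℝ] ℝ :=
  u • ContinuousLinearMap.fst ℝ ℝ ℝ + v • ContinuousLinearMap.snd ℝ ℝ ℝ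

@[simp] theorem planeForm_apply (u v : ℝ) (p : ℝ × ℝ) : planeForm u v p = u * p.1 + v * p.2 := rfl

theorem contDiff_planeForm {n : WithTop ℕ∞} {E : Type*} [NormedAddCommGroup E] [NormedSpace ℝ E]
    {u v : E → ℝ} (hu : ContDiff ℝ n u) (hv : ContDiff ℝ n v) :
    ContDiff ℝ n fun p => planeForm (u p) (v p) :=
  (hu.smul contDiff_const).add (hv.smul contDiff_const)

theorem continuous_planeForm {E : Type*} [TopologicalSpace E]
    {u v : E → ℝ} (hu : Continuous u) (hv : Continuous v) :
    Continuous fun p => planeForm (u p) (v p) :=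
  (hu.smul continuous_const).add (hv.smul continuous_const)

theorem hasFDerivAt_of_continuous_partials {f fx fy : ℝ × ℝ → ℝ}
    (hx : ∀ p, HasDerivAt (fun x => f (x, p.2)) (fx p) p.1)
    (hy : ∀ p, HasDerivAt (fun y => f (p.1, y)) (fy p) p.2)
    (cx : Continuous fx) (cy : Continuous fy) (p : ℝ × ℝ) :
    HasFDerivAt f (planeForm (fx p) (fy p)) p := by
  have h := hasStrictFDerivAt_uncurry_coprod (𝕜 := ℝ) (u := p) (f := fun x y => f (x, y))
    (f₁ := fun x y => ContinuousLinearMap.toSpanSingleton ℝ (fx (x, y)))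
    (f₂ := fun x y => ContinuousLinearMap.toSpanSingleton ℝ (fy (x, y)))
    (Eventually.of_forall fun v => (hx v).hasFDerivAt)
    (Eventually.of_forall fun v => (hy v).hasFDerivAt) ?_ ?_
  · have e : planeForm (fx p) (fy p) = (ContinuousLinearMap.toSpanSingleton ℝ (fx p)).coprod
        (ContinuousLinearMap.toSpanSingleton ℝ (fy p)) := by
      ext <;> simp
    rw [e]
    exact h.hasFDerivAt
  · exact ((ContinuousLinearMap.toSpanSingletonCLE (𝕜 := ℝ) (E := ℝ)).continuous.comp cx).continuousAt
  · exact ((ContinuousLinearMap.toSpanSingletonCLE (𝕜 := ℝ) (E := ℝ)).continuous.comp cy).continuousAt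

/-- The integral of `S` over `0 ≤ z ≤ q.1` along the line through `(0, q.2)` of slope `m`. -/
def lineIntegral (m : ℝ) (S : ℝ × ℝ → ℝ) (q : ℝ × ℝ) : ℝ :=
  ∫ z in (0 : ℝ)..q.1, S (z, q.2 + m * z)

/-- `S` is continuous, locally Lipschitz in `y`, and almost everywhere on every line of slope `m`
it has the partial derivative `Sy` in `y`, which is continuous there. -/
structure RegularAlong (m : ℝ) (S Sy : ℝ × ℝ → ℝ) : Prop where
  cont : Continuous S
  meas : Measurable Sy
  deriv : ∀ w : ℝ, ∀ᵐ z : ℝ, HasDerivAt (fun y => S (z, y)) (Sy (z, w + m * z)) (w + m * z) ∧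
    ContinuousAt Sy (z, w + m * z)
  bdd : ∀ R : ℝ, ∃ C : ℝ, 0 ≤ C ∧ ∀ z y : ℝ, |z| ≤ R → |y| ≤ R → |Sy (z, y)| ≤ C
  lip : ∀ R : ℝ, ∃ C : ℝ, 0 ≤ C ∧ ∀ z y y' : ℝ, |z| ≤ R → |y| ≤ R → |y'| ≤ R →
    |S (z, y) - S (z, y')| ≤ C * |y - y'|

theorem exists_bound_on_square {f : ℝ × ℝ → ℝ} (hf : Continuous f) (R : ℝ) :
    ∃ C : ℝ, 0 ≤ C ∧ ∀ z y : ℝ, |z| ≤ R → |y| ≤ R → |f (z, y)| ≤ C := by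
  obtain ⟨C, hC⟩ := ((isCompact_Icc (a := -R) (b := R)).prod
    (isCompact_Icc (a := -R) (b := R))).exists_bound_of_continuousOn hf.continuousOn
  refine ⟨max C 0, le_max_right _ _, fun z y hz hy => (hC (z, y) ⟨?_, ?_⟩).trans (le_max_left _ _)⟩
  · exact abs_le.1 hz
  · exact abs_le.1 hy

theorem RegularAlong.of_continuous {m : ℝ} {S Sy : ℝ × ℝ → ℝ} (hS : Continuous S)
    (hSy : Continuous Sy) (h : ∀ p : ℝ × ℝ, HasDerivAt (fun y => S (p.1, y)) (Sy p) p.2) :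
    RegularAlong m S Sy where
  cont := hS
  meas := hSy.measurable
  deriv w := Eventually.of_forall fun z => ⟨h (z, w + m * z), hSy.continuousAt⟩
  bdd := exists_bound_on_square hSy
  lip R := by
    obtain ⟨C, hC0, hC⟩ := exists_bound_on_square hSy R
    refine ⟨C, hC0, fun z y y' hz hy hy' => ?_⟩
    have := (convex_Icc (-R) R).norm_image_sub_le_of_norm_hasDerivWithin_le
      (f := fun y => S (z, y)) (f' := fun y => Sy (z, y)) (C := C) (x := y') (y := y)
      (fun x _ => (h (z, x)).hasDerivWithinAt) (fun x hx => hC z x hz (abs_le.2 hx))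
      (abs_le.1 hy') (abs_le.1 hy)
    simpa using this

theorem RegularAlong.of_contDiff {m : ℝ} {S : ℝ × ℝ → ℝ} (hS : ContDiff ℝ 1 S) :
    RegularAlong m S fun p => fderiv ℝ S p (0, 1) := by
  refine .of_continuous hS.continuous
    ((hS.continuous_fderiv one_ne_zero).clm_apply continuous_const) fun p => ?_
  have h1 : HasFDerivAt S (fderiv ℝ S p) (p.1, p.2) :=
    (hS.differentiable one_ne_zero p).hasFDerivAt
  exact h1.comp_hasDerivAt (x := p.2) (f := fun y => (p.1, y))
    ((hasDerivAt_const p.2 p.1).prodMk (hasDerivAt_id p.2))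

theorem RegularAlong.mul {m : ℝ} {S Sy T Ty : ℝ × ℝ → ℝ} (hS : RegularAlong m S Sy)
    (hT : RegularAlong m T Ty) :
    RegularAlong m (fun p => S p * T p) (fun p => Sy p * T p + S p * Ty p) where
  cont := hS.cont.mul hT.cont
  meas := (hS.meas.mul hT.cont.measurable).add (hS.cont.measurable.mul hT.meas)
  deriv w := by
    filter_upwards [hS.deriv w, hT.deriv w] with z h1 h2
    exact ⟨h1.1.mul h2.1, (h1.2.mul hT.cont.continuousAt).add (hS.cont.continuousAt.mul h2.2)⟩
  bdd R := by
    obtain ⟨C1, h1, H1⟩ := hS.bdd R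
    obtain ⟨C2, h2, H2⟩ := hT.bdd R
    obtain ⟨C3, h3, H3⟩ := exists_bound_on_square hS.cont R
    obtain ⟨C4, h4, H4⟩ := exists_bound_on_square hT.cont R
    refine ⟨C1 * C4 + C3 * C2, by positivity, fun z y hz hy => (abs_add_le _ _).trans ?_⟩
    rw [abs_mul, abs_mul]
    gcongr
    exacts [H1 z y hz hy, H4 z y hz hy, H3 z y hz hy, H2 z y hz hy]
  lip R := by
    obtain ⟨C1, h1, H1⟩ := hS.lip R
    obtain ⟨C2, h2, H2⟩ := hT.lip R
    obtain ⟨C3, h3, H3⟩ := exists_bound_on_square hS.cont R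
    obtain ⟨C4, h4, H4⟩ := exists_bound_on_square hT.cont R
    refine ⟨C1 * C4 + C3 * C2, by positivity, fun z y y' hz hy hy' => ?_⟩
    rw [show S (z, y) * T (z, y) - S (z, y') * T (z, y') =
      (S (z, y) - S (z, y')) * T (z, y) + S (z, y') * (T (z, y) - T (z, y')) by ring]
    refine (abs_add_le _ _).trans ?_
    rw [abs_mul, abs_mul, add_mul, mul_right_comm, mul_assoc C3]
    gcongr
    exacts [H1 z y y' hz hy hy', H4 z y hz hy, H3 z y' hz hy', H2 z y y' hz hy hy']

theorem RegularAlong.sub {m : ℝ} {S Sy T Ty : ℝ × ℝ → ℝ} (hS : RegularAlong m S Sy)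
    (hT : RegularAlong m T Ty) :
    RegularAlong m (fun p => S p - T p) (fun p => Sy p - Ty p) where
  cont := hS.cont.sub hT.cont
  meas := hS.meas.sub hT.meas
  deriv w := by
    filter_upwards [hS.deriv w, hT.deriv w] with z h1 h2
    exact ⟨h1.1.sub h2.1, h1.2.sub h2.2⟩
  bdd R := by
    obtain ⟨C1, h1, H1⟩ := hS.bdd R
    obtain ⟨C2, h2, H2⟩ := hT.bdd R
    exact ⟨C1 + C2, by positivity, fun z y hz hy =>
      (abs_sub _ _).trans (add_le_add (H1 z y hz hy) (H2 z y hz hy))⟩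
  lip R := by
    obtain ⟨C1, h1, H1⟩ := hS.lip R
    obtain ⟨C2, h2, H2⟩ := hT.lip R
    refine ⟨C1 + C2, by positivity, fun z y y' hz hy hy' => ?_⟩
    rw [show S (z, y) - T (z, y) - (S (z, y') - T (z, y')) =
      (S (z, y) - S (z, y')) - (T (z, y) - T (z, y')) by ring, add_mul]
    exact (abs_sub _ _).trans (add_le_add (H1 z y y' hz hy hy') (H2 z y y' hz hy hy'))

theorem continuous_lineIntegral {m : ℝ} {S : ℝ × ℝ → ℝ} (hS : Continuous S) :
    Continuous (lineIntegral m S) := by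
  unfold lineIntegral
  refine intervalIntegral.continuous_parametric_intervalIntegral_of_continuous
    (f := fun (q : ℝ × ℝ) z => S (z, q.2 + m * z)) (s := fun q => q.1) ?_ continuous_fst
  simp only [Function.uncurry_def]
  fun_prop

theorem hasDerivAt_lineIntegral_fst {m : ℝ} {S : ℝ × ℝ → ℝ} (hS : Continuous S) (p : ℝ × ℝ) :
    HasDerivAt (fun β => lineIntegral m S (β, p.2)) (S (p.1, p.2 + m * p.1)) p.1 := by
  have hc : Continuous fun z => S (z, p.2 + m * z) := by fun_prop
  exact intervalIntegral.integral_hasDerivAt_right (hc.intervalIntegrable _ _)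
    (hc.stronglyMeasurableAtFilter _ _) hc.continuousAt

theorem RegularAlong.measurable_line {m : ℝ} {S Sy : ℝ × ℝ → ℝ} (h : RegularAlong m S Sy) (w : ℝ) :
    Measurable fun z => Sy (z, w + m * z) :=
  h.meas.comp (by fun_prop)

theorem abs_line_le {m w z R w' : ℝ} (hz : |z| ≤ R) (hw : |w - w'| ≤ 1) :
    |w + m * z| ≤ |w'| + 1 + |m| * R := by
  have h1 : |w| ≤ |w'| + 1 := by
    have := abs_sub_abs_le_abs_sub w w'
    linarith
  calc |w + m * z| ≤ |w| + |m * z| := abs_add_le _ _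
    _ ≤ |w'| + 1 + |m| * R := by rw [abs_mul]; gcongr

/-- Dominated differentiation under the integral: the local Lipschitz constant is the dominating
function, so a y-derivative at almost every point of the single line considered is enough. -/
theorem hasDerivAt_lineIntegral_snd {m : ℝ} {S Sy : ℝ × ℝ → ℝ} (h : RegularAlong m S Sy)
    (p : ℝ × ℝ) :
    HasDerivAt (fun w => lineIntegral m S (p.1, w)) (lineIntegral m Sy p) p.2 := by
  have hS := h.cont
  have hc : ∀ w, Continuous fun z => S (z, w + m * z) := fun w => by fun_prop
  -- `R` bounds both coordinates on every line whose intercept is within 1 of `p.2`, over the range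
  -- of integration.
  set R : ℝ := |p.2| + 1 + |m| * |p.1| + |p.1| with hR
  obtain ⟨C, hC0, hC⟩ := h.lip R
  refine (intervalIntegral.hasDerivAt_integral_of_dominated_loc_of_lip (μ := volume)
    (F := fun w z => S (z, w + m * z)) (bound := fun _ => C)
    (Metric.closedBall_mem_nhds p.2 one_pos)
    (Eventually.of_forall fun w => (hc w).aestronglyMeasurable) ((hc _).intervalIntegrable _ _)
    (h.measurable_line _).aestronglyMeasurable ?_ intervalIntegrable_const ?_).2
  · refine Eventually.of_forall fun z hz => LipschitzOnWith.of_dist_le_mul fun w hw w' hw' => ?_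
    have hz' : |z| ≤ |p.1| := by
      rcases le_total 0 p.1 with h0 | h0
      · rw [uIoc_of_le h0] at hz
        rw [abs_of_nonneg hz.1.le, abs_of_nonneg h0]; exact hz.2
      · rw [uIoc_of_ge h0] at hz
        rw [abs_of_nonpos hz.2, abs_of_nonpos h0]; linarith [hz.1]
    have hle : ∀ v, |v - p.2| ≤ 1 → |v + m * z| ≤ R := fun v hv =>
      (abs_line_le hz' hv).trans (by rw [hR]; linarith [abs_nonneg p.1])
    have := hC z (w + m * z) (w' + m * z)
      (hz'.trans (by rw [hR]; have := abs_nonneg p.2; have := mul_nonneg (abs_nonneg m) (abs_nonneg p.1); linarith))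
      (hle _ hw) (hle _ hw')
    rw [add_sub_add_right_eq_sub] at this
    simpa [Real.dist_eq, abs_of_nonneg hC0] using this
  · filter_upwards [h.deriv p.2] with z hz _
    exact hz.1.comp_add_const (x := p.2) (a := m * z)

/-- `Sy` may jump, but each line of slope `m` meets its discontinuities in a null set, so dominated
convergence still applies. -/
theorem RegularAlong.continuous_lineIntegral_deriv {m : ℝ} {S Sy : ℝ × ℝ → ℝ}
    (h : RegularAlong m S Sy) : Continuous (lineIntegral m Sy) := by
  rw [continuous_iff_continuousAt]
  rintro ⟨β, w⟩
  set R : ℝ := |w| + 1 + |m| * (|β| + 1) + (|β| + 1) with hR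
  obtain ⟨C, hC0, hC⟩ := h.bdd R
  have := intervalIntegral.continuousAt_parametric_primitive_of_dominated (μ := volume)
    (F := fun (w : ℝ) z => Sy (z, w + m * z)) (x₀ := w) (b₀ := β) (a₀ := 0) (fun _ => C)
    (-(|β| + 1)) (|β| + 1) (fun w => (h.measurable_line w).aestronglyMeasurable) ?_
    intervalIntegrable_const ?_ ?_ ?_ (by simp)
  · exact this.comp (f := fun q : ℝ × ℝ => (q.2, q.1)) (x := (β, w)) (by fun_prop)
  · filter_upwards [Metric.closedBall_mem_nhds w one_pos] with v hv
    refine (ae_restrict_iff' measurableSet_uIoc).2 (Eventually.of_forall fun z hz => ?_)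
    rw [uIoc_of_le (by linarith [abs_nonneg β])] at hz
    have hz' : |z| ≤ |β| + 1 := abs_le.2 ⟨hz.1.le, hz.2⟩
    refine hC z _ (hz'.trans ?_) ((abs_line_le hz' hv).trans ?_)
    · rw [hR]
      have := abs_nonneg w
      have := mul_nonneg (abs_nonneg m) (add_nonneg (abs_nonneg β) zero_le_one)
      linarith
    · rw [hR]; linarith [abs_nonneg β]
  · refine ae_restrict_of_ae ?_
    filter_upwards [h.deriv w] with z hz
    exact ContinuousAt.comp (f := fun w : ℝ => (z, w + m * z)) hz.2 (by fun_prop)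
  · exact ⟨by linarith [abs_nonneg β], by linarith [abs_nonneg β]⟩
  · exact ⟨by linarith [neg_abs_le β], by linarith [le_abs_self β]⟩

theorem hasFDerivAt_lineIntegral {m : ℝ} {S Sy : ℝ × ℝ → ℝ} (h : RegularAlong m S Sy)
    (q : ℝ × ℝ) :
    HasFDerivAt (lineIntegral m S)
      (planeForm (S (q.1, q.2 + m * q.1)) (lineIntegral m Sy q)) q := by
  have hS := h.cont
  exact hasFDerivAt_of_continuous_partials (fx := fun q => S (q.1, q.2 + m * q.1))
    (hasDerivAt_lineIntegral_fst h.cont) (hasDerivAt_lineIntegral_snd h) (by fun_prop)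
    h.continuous_lineIntegral_deriv q

theorem contDiff_lineIntegral {m : ℝ} {S Sy : ℝ × ℝ → ℝ} (h : RegularAlong m S Sy) :
    ContDiff ℝ 1 (lineIntegral m S) := by
  have hS := h.cont
  exact contDiff_one_iff_hasFDerivAt.2 ⟨_, continuous_planeForm
    (u := fun q : ℝ × ℝ => S (q.1, q.2 + m * q.1)) (by fun_prop)
    h.continuous_lineIntegral_deriv, hasFDerivAt_lineIntegral h⟩

/-! ### Integrals along the two families of characteristics -/

/-- The integral of `S` along the characteristic of slope `1 / a` from the `x`-axis up to `p`. -/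
def hatInt (a : ℝ) (S : ℝ × ℝ → ℝ) (p : ℝ × ℝ) : ℝ :=
  ∫ z in (p.1 - a * p.2)..p.1, S (z, p.2 - (p.1 - z) / a)

/-- The abscissa at which the line of slope `-1 / a` through `p` meets the diagonal. -/
def diagFoot (a : ℝ) (p : ℝ × ℝ) : ℝ := (p.1 + a * p.2) / (1 + a)

/-- The integral of `S` along the characteristic of slope `-1 / a` from the diagonal down to `p`. -/
def checkInt (a : ℝ) (S : ℝ × ℝ → ℝ) (p : ℝ × ℝ) : ℝ :=
  ∫ z in (diagFoot a p)..p.1, S (z, p.2 + (p.1 - z) / a)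

/-- The intercept `p.2 - a⁻¹ * p.1` labels the characteristic through `p`. Both endpoints share it,
and smoothness of `hatInt` reduces to that of `lineIntegral`. -/
theorem hatInt_eq {a : ℝ} {S : ℝ × ℝ → ℝ} (hS : Continuous S) :
    hatInt a S = fun p => lineIntegral a⁻¹ S (p.1, p.2 - a⁻¹ * p.1) -
      lineIntegral a⁻¹ S (p.1 - a * p.2, p.2 - a⁻¹ * p.1) := by
  funext p
  have hc : Continuous fun z => S (z, p.2 - a⁻¹ * p.1 + a⁻¹ * z) := by fun_prop
  simp only [hatInt, lineIntegral]
  rw [intervalIntegral.integral_interval_sub_left (hc.intervalIntegrable _ _)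
    (hc.intervalIntegrable _ _)]
  congr 1
  funext z
  congr 2
  ring

theorem checkInt_eq {a : ℝ} {S : ℝ × ℝ → ℝ} (hS : Continuous S) :
    checkInt a S = fun p => lineIntegral (-a⁻¹) S (p.1, p.2 + a⁻¹ * p.1) -
      lineIntegral (-a⁻¹) S (diagFoot a p, p.2 + a⁻¹ * p.1) := by
  funext p
  have hc : Continuous fun z => S (z, p.2 + a⁻¹ * p.1 + -a⁻¹ * z) := by fun_prop
  simp only [checkInt, lineIntegral]
  rw [intervalIntegral.integral_interval_sub_left (hc.intervalIntegrable _ _)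
    (hc.intervalIntegrable _ _)]
  congr 1
  funext z
  congr 2
  ring

theorem contDiff_diagFoot {n : WithTop ℕ∞} {a : ℝ} : ContDiff ℝ n (diagFoot a) := by
  unfold diagFoot
  fun_prop

theorem continuous_diagFoot {a : ℝ} : Continuous (diagFoot a) := by
  unfold diagFoot
  fun_prop

theorem continuous_hatInt {a : ℝ} {S : ℝ × ℝ → ℝ} (hS : Continuous S) :
    Continuous (hatInt a S) := by
  rw [hatInt_eq hS]
  have := continuous_lineIntegral (m := a⁻¹) hS
  fun_prop

theorem continuous_checkInt {a : ℝ} {S : ℝ × ℝ → ℝ} (hS : Continuous S) :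
    Continuous (checkInt a S) := by
  rw [checkInt_eq hS]
  have := continuous_lineIntegral (m := -a⁻¹) hS
  have := continuous_diagFoot (a := a)
  fun_prop

theorem contDiff_hatInt {a : ℝ} {S Sy : ℝ × ℝ → ℝ} (h : RegularAlong a⁻¹ S Sy) :
    ContDiff ℝ 1 (hatInt a S) := by
  rw [hatInt_eq h.cont]
  have := contDiff_lineIntegral h
  fun_prop

theorem contDiff_checkInt {a : ℝ} {S Sy : ℝ × ℝ → ℝ} (h : RegularAlong (-a⁻¹) S Sy) :
    ContDiff ℝ 1 (checkInt a S) := by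
  rw [checkInt_eq h.cont]
  have := contDiff_lineIntegral h
  have := contDiff_diagFoot (a := a) (n := 1)
  fun_prop

@[simp] theorem hatInt_axis (a : ℝ) (S : ℝ × ℝ → ℝ) (x : ℝ) : hatInt a S (x, 0) = 0 := by
  simp [hatInt]

theorem diagFoot_diag {a : ℝ} (ha : 0 < a) (x : ℝ) : diagFoot a (x, x) = x := by
  have : 1 + a ≠ 0 := by positivity
  simp only [diagFoot]
  field_simp

theorem checkInt_diag {a : ℝ} (ha : 0 < a) (S : ℝ × ℝ → ℝ) (x : ℝ) : checkInt a S (x, x) = 0 := by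
  simp [checkInt, diagFoot_diag ha]

/-- Along its characteristic, `hatInt a S` has derivative `a * S`. -/
theorem hasDerivAt_hatInt_char {a : ℝ} (ha : 0 < a) {S : ℝ × ℝ → ℝ} (hS : Continuous S)
    (p : ℝ × ℝ) :
    HasDerivAt (fun τ => hatInt a S (p.1 + a * τ, p.2 + τ)) (a * S p) 0 := by
  have e : (fun τ => hatInt a S (p.1 + a * τ, p.2 + τ)) = fun τ =>
      ∫ z in (p.1 - a * p.2)..(p.1 + a * τ), S (z, p.2 - (p.1 - z) / a) := by
    funext τ
    simp only [hatInt]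
    rw [show p.1 + a * τ - a * (p.2 + τ) = p.1 - a * p.2 by ring]
    congr 1
    funext z
    congr 2
    field_simp
    ring
  have hc : Continuous fun z => S (z, p.2 - (p.1 - z) / a) := by fun_prop
  rw [e]
  have h1 : HasDerivAt (fun b => ∫ z in (p.1 - a * p.2)..b, S (z, p.2 - (p.1 - z) / a)) (S p)
      (p.1 + a * 0) := by
    have := intervalIntegral.integral_hasDerivAt_right (hc.intervalIntegrable (p.1 - a * p.2)
      (p.1 + a * 0)) (hc.stronglyMeasurableAtFilter _ _) hc.continuousAt
    simpa using this
  have h2 : HasDerivAt (fun τ : ℝ => p.1 + a * τ) a 0 := by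
    simpa using ((hasDerivAt_id (0 : ℝ)).const_mul a).const_add p.1
  exact (h1.comp 0 h2).congr_deriv (mul_comm _ _)

/-- Along its characteristic, `checkInt a S` has derivative `a * S`. -/
theorem hasDerivAt_checkInt_char {a : ℝ} (ha : 0 < a) {S : ℝ × ℝ → ℝ} (hS : Continuous S)
    (p : ℝ × ℝ) :
    HasDerivAt (fun τ => checkInt a S (p.1 + a * τ, p.2 - τ)) (a * S p) 0 := by
  have e : (fun τ => checkInt a S (p.1 + a * τ, p.2 - τ)) = fun τ =>
      ∫ z in (diagFoot a p)..(p.1 + a * τ), S (z, p.2 + (p.1 - z) / a) := by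
    funext τ
    simp only [checkInt, diagFoot]
    rw [show p.1 + a * τ + a * (p.2 - τ) = p.1 + a * p.2 by ring]
    congr 1
    funext z
    congr 2
    field_simp
    ring
  have hc : Continuous fun z => S (z, p.2 + (p.1 - z) / a) := by fun_prop
  rw [e]
  have h1 : HasDerivAt (fun b => ∫ z in (diagFoot a p)..b, S (z, p.2 + (p.1 - z) / a)) (S p)
      (p.1 + a * 0) := by
    have := intervalIntegral.integral_hasDerivAt_right (hc.intervalIntegrable (diagFoot a p)
      (p.1 + a * 0)) (hc.stronglyMeasurableAtFilter _ _) hc.continuousAt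
    simpa using this
  have h2 : HasDerivAt (fun τ : ℝ => p.1 + a * τ) a 0 := by
    simpa using ((hasDerivAt_id (0 : ℝ)).const_mul a).const_add p.1
  exact (h1.comp 0 h2).congr_deriv (mul_comm _ _)

theorem hasFDerivAt_sub_mul (a : ℝ) (p : ℝ × ℝ) :
    HasFDerivAt (fun p : ℝ × ℝ => p.1 - a * p.2) (planeForm 1 (-a)) p := by
  refine ((hasFDerivAt_fst (𝕜 := ℝ) (p := p)).sub
    ((hasFDerivAt_snd (𝕜 := ℝ) (p := p)).const_mul a)).congr_fderiv ?_
  ext <;> simp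

theorem hasFDerivAt_snd_sub_mul (b : ℝ) (p : ℝ × ℝ) :
    HasFDerivAt (fun p : ℝ × ℝ => p.2 - b * p.1) (planeForm (-b) 1) p := by
  refine ((hasFDerivAt_snd (𝕜 := ℝ) (p := p)).sub
    ((hasFDerivAt_fst (𝕜 := ℝ) (p := p)).const_mul b)).congr_fderiv ?_
  ext <;> simp

theorem hasFDerivAt_diagFoot (a : ℝ) (p : ℝ × ℝ) :
    HasFDerivAt (diagFoot a) (planeForm (1 / (1 + a)) (a / (1 + a))) p := by
  have h := ((hasFDerivAt_fst (𝕜 := ℝ) (p := p)).add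
    ((hasFDerivAt_snd (𝕜 := ℝ) (p := p)).const_mul a)).mul_const (1 + a)⁻¹
  refine h.congr_fderiv ?_
  ext <;> simp [div_eq_inv_mul]

/-- The explicit gradient serves `exists_potential`, where it is applied to a y-primitive of the
source, so that `hatInt a Sy` becomes the integral of the source itself. -/
theorem hasFDerivAt_hatInt {a : ℝ} (ha : 0 < a) {S Sy : ℝ × ℝ → ℝ} (hS : Continuous S)
    (hSy : Continuous Sy) (h : ∀ p : ℝ × ℝ, HasDerivAt (fun y => S (p.1, y)) (Sy p) p.2)
    (p : ℝ × ℝ) :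
    HasFDerivAt (hatInt a S) (planeForm (S p - S (p.1 - a * p.2, 0) - a⁻¹ * hatInt a Sy p)
      (a * S (p.1 - a * p.2, 0) + hatInt a Sy p)) p := by
  have hr : RegularAlong a⁻¹ S Sy := .of_continuous hS hSy h
  rw [hatInt_eq hS, hatInt_eq hSy]
  have h1 := (hasFDerivAt_lineIntegral hr (p.1, p.2 - a⁻¹ * p.1)).comp p
    ((hasFDerivAt_fst (𝕜 := ℝ) (p := p)).prodMk (hasFDerivAt_snd_sub_mul a⁻¹ p))
  have h2 := (hasFDerivAt_lineIntegral hr (p.1 - a * p.2, p.2 - a⁻¹ * p.1)).comp p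
    ((hasFDerivAt_sub_mul a p).prodMk (hasFDerivAt_snd_sub_mul a⁻¹ p))
  refine (h1.sub h2).congr_fderiv ?_
  have e : p.2 - a⁻¹ * p.1 + a⁻¹ * (p.1 - a * p.2) = 0 := by
    field_simp
    ring
  ext <;> simp [e] <;> ring

theorem hasFDerivAt_checkInt {a : ℝ} (ha : 0 < a) {S Sy : ℝ × ℝ → ℝ} (hS : Continuous S)
    (hSy : Continuous Sy) (h : ∀ p : ℝ × ℝ, HasDerivAt (fun y => S (p.1, y)) (Sy p) p.2)
    (p : ℝ × ℝ) :
    HasFDerivAt (checkInt a S)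
      (planeForm (S p - S (diagFoot a p, diagFoot a p) / (1 + a) + a⁻¹ * checkInt a Sy p)
        (-(a * S (diagFoot a p, diagFoot a p) / (1 + a)) + checkInt a Sy p)) p := by
  have hr : RegularAlong (-a⁻¹) S Sy := .of_continuous hS hSy h
  rw [checkInt_eq hS, checkInt_eq hSy]
  have h0 : HasFDerivAt (fun p : ℝ × ℝ => p.2 + a⁻¹ * p.1) (planeForm a⁻¹ 1) p := by
    simpa using hasFDerivAt_snd_sub_mul (-a⁻¹) p
  have h1 := (hasFDerivAt_lineIntegral hr (p.1, p.2 + a⁻¹ * p.1)).comp p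
    ((hasFDerivAt_fst (𝕜 := ℝ) (p := p)).prodMk h0)
  have h2 := (hasFDerivAt_lineIntegral hr (diagFoot a p, p.2 + a⁻¹ * p.1)).comp p
    ((hasFDerivAt_diagFoot a p).prodMk h0)
  refine (h1.sub h2).congr_fderiv ?_
  have ha' : 1 + a ≠ 0 := by positivity
  have e : p.2 + a⁻¹ * p.1 + -(a⁻¹ * diagFoot a p) = diagFoot a p := by
    simp only [diagFoot]
    field_simp
    ring
  ext <;> simp [e] <;> ring

/-! ### The potential of a pair of transported invariants -/

/-- D'Alembert's formula: the form `(kh + kc) dx + a (kc - kh) dy` is exact when `kh`, `kc` are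
transported along their characteristics with the same continuous source. -/
theorem exists_potential {a μ : ℝ} (ha : 0 < a) {H C : ℝ → ℝ} {S : ℝ × ℝ → ℝ}
    (hH : Continuous H) (hC : Continuous C) (hS : Continuous S) {kh kc : ℝ × ℝ → ℝ}
    (hkh : ∀ p, kh p = H (p.1 - a * p.2) + 1 / μ * hatInt a S p)
    (hkc : ∀ p, kc p = C (diagFoot a p) + 1 / μ * checkInt a S p) :
    ∃ W : ℝ × ℝ → ℝ, ∀ p, HasFDerivAt W (planeForm (kh p + kc p) (a * (kc p - kh p))) p := by
  -- `S` is only continuous, so `kh` and `kc` cannot be differentiated to test closedness.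
  -- Characteristic integrals of the y-primitive `Θ` are differentiable, and their gradients contain
  -- the integrals of `S`.
  set Θ : ℝ × ℝ → ℝ := fun p => ∫ t in (0 : ℝ)..p.2, S (p.1, t) with hΘ
  have cΘ : Continuous Θ := by
    refine intervalIntegral.continuous_parametric_intervalIntegral_of_continuous
      (f := fun (q : ℝ × ℝ) t => S (q.1, t)) (s := fun q => q.2) ?_ continuous_snd
    simp only [Function.uncurry_def]
    fun_prop
  have dΘ : ∀ p : ℝ × ℝ, HasDerivAt (fun y => Θ (p.1, y)) (S p) p.2 := fun p => by
    have hc : Continuous fun t => S (p.1, t) := by fun_prop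
    exact intervalIntegral.integral_hasDerivAt_right (hc.intervalIntegrable _ _)
      (hc.stronglyMeasurableAtFilter _ _) hc.continuousAt
  have prim : ∀ {F : ℝ → ℝ}, Continuous F → ∀ x, HasDerivAt (fun x => ∫ t in (0 : ℝ)..x, F t) (F x) x :=
    fun hF x => intervalIntegral.integral_hasDerivAt_right (hF.intervalIntegrable _ _)
      (hF.stronglyMeasurableAtFilter _ _) hF.continuousAt
  have cD : Continuous fun t => Θ (t, t) := by fun_prop
  -- The first two terms are the free waves. In the third, the values `Θ p` cancel between the two
  -- characteristic integrals, `Θ` vanishes on the axis, and the integral of `Θ (t, t)` removes the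
  -- boundary term at the diagonal.
  refine ⟨fun p => (∫ t in (0 : ℝ)..(p.1 - a * p.2), H t) +
    (1 + a) * (∫ t in (0 : ℝ)..(diagFoot a p), C t) +
    a / μ * (checkInt a Θ p - hatInt a Θ p + ∫ t in (0 : ℝ)..(diagFoot a p), Θ (t, t)),
    fun p => ?_⟩
  have h1 := (prim hH (p.1 - a * p.2)).hasFDerivAt.comp p (hasFDerivAt_sub_mul a p)
  have h2 := (prim hC (diagFoot a p)).hasFDerivAt.comp p (hasFDerivAt_diagFoot a p)
  have h3 := (prim cD (diagFoot a p)).hasFDerivAt.comp p (hasFDerivAt_diagFoot a p)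
  have h4 := hasFDerivAt_hatInt ha cΘ hS dΘ p
  have h5 := hasFDerivAt_checkInt ha cΘ hS dΘ p
  refine ((h1.add (h2.const_mul (1 + a))).add (((h5.sub h4).add h3).const_mul (a / μ))).congr_fderiv
    ?_
  have ha' : 1 + a ≠ 0 := by positivity
  have e0 : Θ (p.1 - a * p.2, 0) = 0 := by simp [hΘ]
  ext
  · simp [hkh, hkc, e0]
    field_simp
    ring
  · simp [hkh, hkc, e0]
    field_simp
    ring

/-! ### Extending the data off the interval and the triangle -/

/-- The nearest point of `[0, 1]`. -/
def clamp (x : ℝ) : ℝ := max 0 (min x 1)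

theorem clamp_of_mem {x : ℝ} (hx : x ∈ Icc (0 : ℝ) 1) : clamp x = x := by
  simp [clamp, hx.1, hx.2]

theorem clamp_mem (x : ℝ) : clamp x ∈ Icc (0 : ℝ) 1 := by
  simp [clamp]

theorem continuous_clamp : Continuous clamp := by
  unfold clamp
  fun_prop

theorem continuous_integral_snd {f : ℝ × ℝ → ℝ} (hf : Continuous f) {l u : ℝ × ℝ → ℝ}
    (hl : Continuous l) (hu : Continuous u) : Continuous fun p => ∫ t in (l p)..(u p), f (p.1, t) := by
  have key : ∀ {v : ℝ × ℝ → ℝ}, Continuous v →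
      Continuous fun p : ℝ × ℝ => ∫ t in (0 : ℝ)..(v p), f (p.1, t) := fun hv =>
    intervalIntegral.continuous_parametric_intervalIntegral_of_continuous
      (f := fun (q : ℝ × ℝ) t => f (q.1, t)) (by simp only [Function.uncurry_def]; fun_prop) hv
  refine ((key hu).sub (key hl)).congr fun p => ?_
  have hc : Continuous fun t => f (p.1, t) := by fun_prop
  exact intervalIntegral.integral_interval_sub_left (hc.intervalIntegrable _ _)
    (hc.intervalIntegrable _ _)

theorem hasDerivAt_primitive {F : ℝ → ℝ} (hF : Continuous F) (c x : ℝ) :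
    HasDerivAt (fun x => ∫ t in c..x, F t) (F x) x :=
  intervalIntegral.integral_hasDerivAt_right (hF.intervalIntegrable _ _)
    (hF.stronglyMeasurableAtFilter _ _) hF.continuousAt

theorem contDiff_primitive {F : ℝ → ℝ} (hF : Continuous F) (c : ℝ) :
    ContDiff ℝ 1 fun x => ∫ t in c..x, F t := by
  have h := hasDerivAt_primitive hF c
  refine contDiff_one_iff_deriv.2 ⟨fun x => (h x).differentiableAt, ?_⟩
  rwa [show deriv (fun x => ∫ t in c..x, F t) = F from funext fun x => (h x).deriv]

/-- The derivative is frozen at its endpoint values outside the interval and integrated back. -/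
theorem exists_contDiff_extension {f : ℝ → ℝ} (hf : ContDiffOn ℝ 1 f (Icc 0 1)) :
    ∃ g : ℝ → ℝ, ContDiff ℝ 1 g ∧ EqOn g f (Icc 0 1) := by
  have hu : UniqueDiffOn ℝ (Icc (0 : ℝ) 1) := uniqueDiffOn_Icc one_pos
  have hd : ContinuousOn (derivWithin f (Icc 0 1)) (Icc 0 1) :=
    hf.continuousOn_derivWithin hu le_rfl
  have hc : Continuous fun t => derivWithin f (Icc 0 1) (clamp t) :=
    hd.comp_continuous continuous_clamp clamp_mem
  refine ⟨fun x => f 0 + ∫ t in (0 : ℝ)..x, derivWithin f (Icc 0 1) (clamp t),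
    contDiff_const.add (contDiff_primitive hc 0), fun x hx => ?_⟩
  have := intervalIntegral.integral_eq_sub_of_hasDerivAt_of_le (f := f)
    (f' := fun t => derivWithin f (Icc 0 1) (clamp t)) hx.1
    (hf.continuousOn.mono (Icc_subset_Icc_right hx.2)) (fun t ht => ?_) (hc.intervalIntegrable _ _)
  · dsimp only
    linarith
  · have ht' : t ∈ Icc (0 : ℝ) 1 := ⟨ht.1.le, ht.2.le.trans hx.2⟩
    rw [clamp_of_mem ht']
    exact ((hf.differentiableOn one_ne_zero t ht').hasDerivWithinAt).hasDerivAt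
      (Icc_mem_nhds ht.1 (ht.2.trans_le hx.2))

/-- The closed triangle between the lines of slopes `α` and `β` with `0 ≤ x ≤ 1`. -/
def sector (α β : ℝ) : Set (ℝ × ℝ) :=
  {p | p.1 ∈ Icc (0 : ℝ) 1 ∧ α * p.1 ≤ p.2 ∧ p.2 ≤ β * p.1}

theorem triangle_eq_sector : triangle = sector 0 1 := by
  ext p
  simp only [triangle, sector, mem_ofPred_eq, mem_Icc, zero_mul, one_mul]
  constructor
  · rintro ⟨h1, h2, h3⟩
    exact ⟨⟨h1.trans h2, h3⟩, h1, h2⟩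
  · rintro ⟨⟨_, h3⟩, h1, h2⟩
    exact ⟨h1, h2, h3⟩

theorem convex_sector (α β : ℝ) : Convex ℝ (sector α β) := by
  rintro p ⟨⟨h1, h2⟩, h3, h4⟩ q ⟨⟨h1', h2'⟩, h3', h4'⟩ s t hs ht hst
  simp only [sector, mem_ofPred_eq, mem_Icc, Prod.fst_add, Prod.smul_fst, Prod.snd_add,
    Prod.smul_snd, smul_eq_mul]
  refine ⟨⟨by positivity, ?_⟩, ?_, ?_⟩
  · nlinarith
  · nlinarith [mul_le_mul_of_nonneg_left h3 hs, mul_le_mul_of_nonneg_left h3' ht]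
  · nlinarith [mul_le_mul_of_nonneg_left h4 hs, mul_le_mul_of_nonneg_left h4' ht]

theorem uniqueDiffOn_sector {α β : ℝ} (h : α < β) : UniqueDiffOn ℝ (sector α β) := by
  refine uniqueDiffOn_convex (convex_sector α β) ⟨(1 / 2, (α + β) / 2 * (1 / 2)), ?_⟩
  have ho : IsOpen {p : ℝ × ℝ | 0 < p.1 ∧ p.1 < 1 ∧ α * p.1 < p.2 ∧ p.2 < β * p.1} := by
    refine (isOpen_lt (by fun_prop) (by fun_prop)).and ((isOpen_lt (by fun_prop) (by fun_prop)).and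
      ((isOpen_lt (by fun_prop) (by fun_prop)).and (isOpen_lt (by fun_prop) (by fun_prop))))
  refine interior_maximal (fun p hp => ?_) ho ?_
  · exact ⟨⟨hp.1.le, hp.2.1.le⟩, hp.2.2.1.le, hp.2.2.2.le⟩
  · refine ⟨by norm_num, by norm_num, ?_, ?_⟩ <;> dsimp only <;> linarith

theorem uniqueDiffOn_triangle : UniqueDiffOn ℝ triangle :=
  triangle_eq_sector ▸ uniqueDiffOn_sector one_pos

/-- A continuous retraction of the plane onto `sector α β`. -/
def sectorRetract (α β : ℝ) (p : ℝ × ℝ) : ℝ × ℝ :=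
  (clamp p.1, max (α * clamp p.1) (min p.2 (β * clamp p.1)))

theorem continuous_sectorRetract (α β : ℝ) : Continuous (sectorRetract α β) := by
  have := continuous_clamp
  unfold sectorRetract
  fun_prop

theorem sectorRetract_mem {α β : ℝ} (h : α ≤ β) (p : ℝ × ℝ) : sectorRetract α β p ∈ sector α β := by
  have hc := clamp_mem p.1
  refine ⟨hc, le_max_left _ _, max_le ?_ (min_le_right _ _)⟩
  exact mul_le_mul_of_nonneg_right h hc.1

theorem sectorRetract_of_mem {α β : ℝ} {p : ℝ × ℝ} (hp : p ∈ sector α β) :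
    sectorRetract α β p = p := by
  obtain ⟨h1, h2, h3⟩ := hp
  simp [sectorRetract, clamp_of_mem h1, h2, h3]

/-- The `y`-derivative of a `C¹` function on a sector extends continuously to the plane. -/
theorem exists_continuous_snd_deriv {α β : ℝ} (h : α < β) {f : ℝ × ℝ → ℝ}
    (hf : ContDiffOn ℝ 1 f (sector α β)) :
    ∃ fy : ℝ × ℝ → ℝ, Continuous fy ∧ ∀ x y y', (x, y) ∈ sector α β → (x, y') ∈ sector α β →
      y' ≤ y → f (x, y) = f (x, y') + ∫ t in y'..y, fy (x, t) := by
  have hd : ContinuousOn (fun p => fderivWithin ℝ f (sector α β) p (0, 1)) (sector α β) :=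
    (hf.continuousOn_fderivWithin (uniqueDiffOn_sector h) le_rfl).clm_apply continuousOn_const
  have hc : Continuous fun p => fderivWithin ℝ f (sector α β) (sectorRetract α β p) (0, 1) :=
    hd.comp_continuous (continuous_sectorRetract α β) (sectorRetract_mem h.le)
  refine ⟨_, hc, fun x y y' hy hy' hle => ?_⟩
  have hseg : ∀ t ∈ Icc y' y, (x, t) ∈ sector α β := fun t ht =>
    ⟨hy.1, hy'.2.1.trans ht.1, ht.2.trans hy.2.2⟩
  have := intervalIntegral.integral_eq_sub_of_hasDerivAt_of_le (f := fun t => f (x, t))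
    (f' := fun t => fderivWithin ℝ f (sector α β) (sectorRetract α β (x, t)) (0, 1)) hle
    (hf.continuousOn.comp (by fun_prop) hseg) (fun t ht => ?_)
    (Continuous.intervalIntegrable (hc.comp (by fun_prop : Continuous fun t : ℝ => (x, t))) _ _)
  · linarith
  · have ht' := hseg t (Ioo_subset_Icc_self ht)
    rw [sectorRetract_of_mem ht']
    have h1 := (hf.differentiableOn one_ne_zero (x, t) ht').hasFDerivWithinAt
    have h2 := h1.comp_hasDerivWithinAt (s := Icc y' y) t
      (f := fun t => (x, t)) ((hasDerivWithinAt_const _ _ _).prodMk (hasDerivWithinAt_id _ _)) hseg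
    exact h2.hasDerivAt (Icc_mem_nhds ht.1 ht.2)

/-- `RegularAlong` asks nothing of x-derivatives, so the trace on the axis can be clamped and a
continuous extension of the y-derivative integrated upwards from it. -/
theorem exists_regular_extension {k : ℝ × ℝ → ℝ} (hk : ContDiffOn ℝ 1 k triangle) :
    ∃ g gy : ℝ × ℝ → ℝ, EqOn g k triangle ∧ ∀ m, RegularAlong m g gy := by
  rw [triangle_eq_sector] at hk ⊢
  obtain ⟨ky, hky, h⟩ := exists_continuous_snd_deriv one_pos hk
  have hbase : Continuous fun p : ℝ × ℝ => k (clamp p.1, 0) :=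
    hk.continuousOn.comp_continuous (by have := continuous_clamp; fun_prop) fun p =>
      ⟨clamp_mem _, by simp, by simpa using (clamp_mem p.1).1⟩
  refine ⟨fun p => k (clamp p.1, 0) + ∫ t in (0 : ℝ)..p.2, ky (p.1, t), ky, ?_, fun m => ?_⟩
  · rintro ⟨x, y⟩ hp
    have h0 : (x, (0 : ℝ)) ∈ sector 0 1 := ⟨hp.1, by simp, by simpa using hp.1.1⟩
    simp only [clamp_of_mem hp.1]
    exact (h x y 0 hp h0 (by simpa using hp.2.1)).symm
  · refine .of_continuous (hbase.add (continuous_integral_snd hky continuous_const continuous_snd))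
      hky fun p => ?_
    have hc : Continuous fun t => ky (p.1, t) := by fun_prop
    exact (hasDerivAt_primitive hc 0 p.2).const_add (k (clamp p.1, 0))

theorem abs_min_le {x y R : ℝ} (hx : |x| ≤ R) (hy : |y| ≤ R) : |min x y| ≤ R := by
  rcases min_choice x y with h | h <;> rwa [h]

theorem abs_max_le {x y R : ℝ} (hx : |x| ≤ R) (hy : |y| ≤ R) : |max x y| ≤ R := by
  rcases max_choice x y with h | h <;> rwa [h]

theorem abs_integral_sub_le {f : ℝ × ℝ → ℝ} (hf : Continuous f) {R C z c u v : ℝ}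
    (hC : ∀ z y : ℝ, |z| ≤ R → |y| ≤ R → |f (z, y)| ≤ C) (hz : |z| ≤ R) (hu : |u| ≤ R)
    (hv : |v| ≤ R) :
    |(∫ t in c..u, f (z, t)) - ∫ t in c..v, f (z, t)| ≤ C * |u - v| := by
  have hc : Continuous fun t => f (z, t) := by fun_prop
  rw [intervalIntegral.integral_interval_sub_left (hc.intervalIntegrable _ _)
    (hc.intervalIntegrable _ _)]
  refine intervalIntegral.norm_integral_le_of_norm_le_const (f := fun t => f (z, t))
    fun t ht => hC z t hz ?_
  have ht' := uIoc_subset_uIcc ht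
  have hs : uIcc v u ⊆ Icc (-R) R :=
    uIcc_subset_Icc (abs_le.1 hv) (abs_le.1 hu)
  exact abs_le.2 (hs ht')

/-- A continuous function which is `C¹` on each side of the ray `y = a x` has an extension which is
regular along every line transversal to that ray. -/
theorem exists_piecewise_regular_extension {a : ℝ} (ha : 0 < a) (ha1 : a < 1) {k : ℝ × ℝ → ℝ}
    (hl : ContDiffOn ℝ 1 k (sector 0 a)) (hu : ContDiffOn ℝ 1 k (sector a 1)) :
    ∃ g gy : ℝ × ℝ → ℝ, EqOn g k triangle ∧ ∀ m, m ≠ a → RegularAlong m g gy := by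
  rw [triangle_eq_sector]
  obtain ⟨L, hL, hLi⟩ := exists_continuous_snd_deriv ha hl
  obtain ⟨U, hU, hUi⟩ := exists_continuous_snd_deriv ha1 hu
  have hbase : Continuous fun p : ℝ × ℝ => k (clamp p.1, 0) :=
    hl.continuousOn.comp_continuous (by have := continuous_clamp; fun_prop) fun p =>
      ⟨clamp_mem _, by simp, mul_nonneg ha.le (clamp_mem p.1).1⟩
  -- The y-derivative is integrated upwards from the axis, switching from `L` to `U` at the ray;
  -- `min` and `max` make this one formula, continuous across the ray.
  refine ⟨fun p => k (clamp p.1, 0) + (∫ t in (0 : ℝ)..min p.2 (a * p.1), L (p.1, t)) +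
    ∫ t in (a * p.1)..max p.2 (a * p.1), U (p.1, t),
    fun p => if p.2 ≤ a * p.1 then L p else U p, ?_, fun m hm => ⟨?_, ?_, fun w => ?_, fun R => ?_,
    fun R => ?_⟩⟩
  · rintro ⟨x, y⟩ hp
    have h0 : (x, (0 : ℝ)) ∈ sector 0 a := ⟨hp.1, by simp, mul_nonneg ha.le hp.1.1⟩
    simp only [clamp_of_mem hp.1]
    have hax : 0 ≤ a * x := mul_nonneg ha.le hp.1.1
    rcases le_total y (a * x) with hy | hy
    · rw [min_eq_left hy, max_eq_right hy, intervalIntegral.integral_same, add_zero]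
      exact (hLi x y 0 ⟨hp.1, hp.2.1, hy⟩ h0 (by simpa using hp.2.1)).symm
    · rw [min_eq_right hy, max_eq_left hy,
        ← hLi x (a * x) 0 ⟨hp.1, by simpa using hax, le_rfl⟩ h0 hax]
      refine (hUi x y (a * x) ⟨hp.1, hy, hp.2.2⟩ ⟨hp.1, le_rfl, ?_⟩ hy).symm
      exact hy.trans hp.2.2
  · exact (hbase.add (continuous_integral_snd hL (by fun_prop) (by fun_prop))).add
      (continuous_integral_snd hU (by fun_prop) (by fun_prop))
  · exact Measurable.ite (measurableSet_le (by fun_prop) (by fun_prop)) hL.measurable hU.measurable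
  · have hne : ∀ᵐ z : ℝ, z ≠ w / (a - m) := by
      simp [ae_iff]
    filter_upwards [hne] with z hz
    have hz' : w + m * z ≠ a * z := fun h => hz <| by
      rw [eq_div_iff (sub_ne_zero.2 hm.symm)]
      linarith
    have cL : Continuous fun t => L (z, t) := by fun_prop
    have cU : Continuous fun t => U (z, t) := by fun_prop
    rcases lt_or_gt_of_ne hz' with h | h
    · constructor
      · rw [if_pos (by exact h.le)]
        refine HasDerivAt.congr_of_eventuallyEq
          (((hasDerivAt_primitive cL 0 (w + m * z)).const_add (k (clamp z, 0)))) ?_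
        filter_upwards [eventually_lt_nhds h] with y hy
        simp [min_eq_left hy.le, max_eq_right hy.le]
      · refine hL.continuousAt.congr ?_
        have : ∀ᶠ p : ℝ × ℝ in 𝓝 (z, w + m * z), p.2 < a * p.1 :=
          (isOpen_lt (by fun_prop) (by fun_prop)).mem_nhds h
        filter_upwards [this] with p hp
        rw [if_pos hp.le]
    · constructor
      · rw [if_neg (by exact not_le.2 h)]
        refine HasDerivAt.congr_of_eventuallyEq
          (((hasDerivAt_primitive cU (a * z) (w + m * z)).const_add
            (k (clamp z, 0) + ∫ t in (0 : ℝ)..a * z, L (z, t)))) ?_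
        filter_upwards [eventually_gt_nhds h] with y hy
        simp [min_eq_right hy.le, max_eq_left hy.le]
      · refine hU.continuousAt.congr ?_
        have : ∀ᶠ p : ℝ × ℝ in 𝓝 (z, w + m * z), a * p.1 < p.2 :=
          (isOpen_lt (by fun_prop) (by fun_prop)).mem_nhds h
        filter_upwards [this] with p hp
        rw [if_neg (not_le.2 hp)]
  · obtain ⟨C1, h1, H1⟩ := exists_bound_on_square hL R
    obtain ⟨C2, h2, H2⟩ := exists_bound_on_square hU R
    refine ⟨max C1 C2, le_max_of_le_left h1, fun z y hz hy => ?_⟩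
    split_ifs
    · exact (H1 z y hz hy).trans (le_max_left _ _)
    · exact (H2 z y hz hy).trans (le_max_right _ _)
  · obtain ⟨C1, h1, H1⟩ := exists_bound_on_square hL R
    obtain ⟨C2, h2, H2⟩ := exists_bound_on_square hU R
    refine ⟨C1 + C2, by positivity, fun z y y' hz hy hy' => ?_⟩
    have haz : |a * z| ≤ R := by
      rw [abs_mul, abs_of_pos ha]
      nlinarith [abs_nonneg z]
    have e1 := abs_integral_sub_le (c := 0) hL H1 hz (abs_min_le hy haz) (abs_min_le hy' haz)
    have e2 := abs_integral_sub_le (c := a * z) hU H2 hz (abs_max_le hy haz) (abs_max_le hy' haz)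
    have m1 : |min y (a * z) - min y' (a * z)| ≤ |y - y'| := by
      simpa using abs_min_sub_min_le_max y (a * z) y' (a * z)
    have m2 : |max y (a * z) - max y' (a * z)| ≤ |y - y'| := by
      simpa using abs_max_sub_max_le_max y (a * z) y' (a * z)
    dsimp only
    rw [add_sub_add_comm, add_sub_add_left_eq_sub, add_mul]
    refine (abs_add_le _ _).trans (add_le_add (e1.trans ?_) (e2.trans ?_)) <;> gcongr

/-! ### The dilation equation for a boundary trace -/

/-- A continuous solution of `H x = κ H (ρ x) + F x` with `C¹` datum `F` is `C¹`. -/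
theorem exists_contDiff_of_dilation_eq {κ ρ : ℝ} (hκ : |κ| < 1) (hρ0 : 0 ≤ ρ) (hρ1 : ρ ≤ 1)
    {F H : ℝ → ℝ} (hF : ContDiff ℝ 1 F) (hH : Continuous H)
    (h : ∀ x ∈ Icc (0 : ℝ) 1, H x = κ * H (ρ * x) + F x) :
    ∃ G : ℝ → ℝ, ContDiff ℝ 1 G ∧ EqOn G H (Icc 0 1) := by
  have hmap : ∀ x ∈ Icc (0 : ℝ) 1, ρ * x ∈ Icc (0 : ℝ) 1 := fun x hx =>
    ⟨mul_nonneg hρ0 hx.1, mul_le_one₀ hρ1 hx.1 hx.2⟩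
  have cF : Continuous (deriv F) := hF.continuous_deriv le_rfl
  obtain ⟨M, hM⟩ := isCompact_Icc.exists_bound_of_continuousOn (s := Icc (0 : ℝ) 1) cF.continuousOn
  have hpow : ∀ n : ℕ, ∀ x ∈ Icc (0 : ℝ) 1, ρ ^ n * x ∈ Icc (0 : ℝ) 1 := fun n x hx =>
    ⟨by have := hx.1; positivity, mul_le_one₀ (pow_le_one₀ hρ0 hρ1) hx.1 hx.2⟩
  have hκρ : |κ * ρ| < 1 := by
    rw [abs_mul, abs_of_nonneg hρ0]
    nlinarith [abs_nonneg κ]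
  have hb : ∀ (n : ℕ) (x : ℝ), ‖(κ * ρ) ^ n * deriv F (ρ ^ n * clamp x)‖ ≤ |κ * ρ| ^ n * M := by
    intro n x
    rw [norm_mul, norm_pow, Real.norm_eq_abs]
    gcongr
    exact hM _ (hpow n _ (clamp_mem x))
  have hsum : Summable fun n : ℕ => |κ * ρ| ^ n * M :=
    (summable_geometric_of_lt_one (abs_nonneg _) hκρ).mul_right M
  -- `D` is the derivative obtained by iterating the differentiated equation H' x = κ ρ H' (ρ x) +
  -- F' x.
  set D : ℝ → ℝ := fun x => ∑' n : ℕ, (κ * ρ) ^ n * deriv F (ρ ^ n * clamp x) with hD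
  have cD : Continuous D := continuous_tsum
    (fun n => by have := continuous_clamp; fun_prop) hsum hb
  have eD : ∀ x ∈ Icc (0 : ℝ) 1, D x = deriv F x + ρ * (κ * D (ρ * x)) := by
    intro x hx
    simp only [hD]
    rw [(Summable.of_norm_bounded hsum (hb · x)).tsum_eq_zero_add, clamp_of_mem hx,
      clamp_of_mem (hmap x hx), ← tsum_mul_left, ← tsum_mul_left]
    simp only [pow_zero, one_mul]
    congr 2
    funext n
    rw [pow_succ, pow_succ, mul_assoc (ρ ^ n)]
    ring
  -- The constant `H 0` makes `G` satisfy the undifferentiated equation, by the equation for `H` at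
  -- 0.
  set G : ℝ → ℝ := fun x => H 0 + ∫ t in (0 : ℝ)..x, D t with hG
  have eG : ∀ x ∈ Icc (0 : ℝ) 1, G x = κ * G (ρ * x) + F x := by
    intro x hx
    have i1 : ∫ t in (0 : ℝ)..x, D t = ∫ t in (0 : ℝ)..x, (deriv F t + ρ * (κ * D (ρ * t))) := by
      refine intervalIntegral.integral_congr fun t ht => eD t ?_
      rw [uIcc_of_le hx.1] at ht
      exact ⟨ht.1, ht.2.trans hx.2⟩
    have i2 : ∫ t in (0 : ℝ)..x, deriv F t = F x - F 0 :=
      intervalIntegral.integral_deriv_eq_sub (fun t _ => hF.differentiable one_ne_zero t)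
        (cF.intervalIntegrable _ _)
    have i3 : ∫ t in (0 : ℝ)..x, ρ * (κ * D (ρ * t)) = κ * ∫ t in (0 : ℝ)..(ρ * x), D t := by
      rw [intervalIntegral.integral_const_mul,
        intervalIntegral.mul_integral_comp_mul_left (f := fun t => κ * D t), mul_zero,
        intervalIntegral.integral_const_mul]
    have h0 := h 0 (by simp)
    simp only [hG]
    rw [i1, intervalIntegral.integral_add (cF.intervalIntegrable _ _)
      (Continuous.intervalIntegrable (by fun_prop) _ _), i2, i3]
    rw [mul_zero] at h0
    linarith
  have cG : ContDiff ℝ 1 G := contDiff_const.add (contDiff_primitive cD 0)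
  refine ⟨G, cG, ?_⟩
  obtain ⟨B, hB⟩ := isCompact_Icc.exists_bound_of_continuousOn (s := Icc (0 : ℝ) 1)
    (cG.continuous.sub hH).continuousOn
  -- The error `G - H` solves the homogeneous equation, so each iteration gains a factor `|κ|`; `H`
  -- is never differentiated.
  have hn : ∀ n : ℕ, ∀ x ∈ Icc (0 : ℝ) 1, |G x - H x| ≤ |κ| ^ n * B := by
    intro n
    induction n with
    | zero => simpa using hB
    | succ n ih =>
      intro x hx
      rw [eG x hx, h x hx, add_sub_add_right_eq_sub, ← mul_sub, abs_mul, pow_succ', mul_assoc]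
      exact mul_le_mul_of_nonneg_left (ih _ (hmap x hx)) (abs_nonneg _)
  intro x hx
  have ht : Tendsto (fun n : ℕ => |κ| ^ n * B) atTop (𝓝 0) := by
    simpa using (tendsto_pow_atTop_nhds_zero_of_lt_one (abs_nonneg κ) hκ).mul_const B
  have := ge_of_tendsto' ht fun n => hn n x hx
  exact sub_eq_zero.1 (abs_nonpos_iff.1 this)

/-! ### Fixed points of maps contracting in a weighted supremum norm -/

section WeightedContraction

variable {X ι : Type*} [TopologicalSpace X] [Fintype ι] {T : Set X}
  {Φ : (ι → X → ℝ) → ι → X → ℝ} {w : ι → X → ℝ} {θ : ℝ}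

/-- Dividing by the weights turns the estimate into an ordinary contraction on C(T, ι → ℝ), where
Banach's theorem applies. The retraction supplies the globally defined functions on which `Φ` acts.
-/
theorem exists_fixedPoint_of_weighted_contraction (hT : IsCompact T) {ρ : X → X}
    (hρ : Continuous ρ) (hρT : ∀ x, ρ x ∈ T) (hρid : ∀ x ∈ T, ρ x = x)
    (hΦ : ∀ u, (∀ i, Continuous (u i)) → ∀ i, Continuous (Φ u i))
    (hw : ∀ i, Continuous (w i)) (hw0 : ∀ i x, 0 < w i x) (hθ0 : 0 ≤ θ) (hθ1 : θ < 1)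
    (hc : ∀ u v, (∀ i, Continuous (u i)) → (∀ i, Continuous (v i)) → ∀ D, 0 ≤ D →
      (∀ i, ∀ p ∈ T, |u i p - v i p| ≤ D * w i p) →
      ∀ i, ∀ p ∈ T, |Φ u i p - Φ v i p| ≤ θ * D * w i p) :
    ∃ u, (∀ i, Continuous (u i)) ∧ ∀ i, ∀ p ∈ T, u i p = Φ u i p := by
  have : CompactSpace T := isCompact_iff_compactSpace.1 hT
  set ext : C(T, ι → ℝ) → ι → X → ℝ := fun v i x => w i x * v ⟨ρ x, hρT x⟩ i with hext
  have cext : ∀ v i, Continuous (ext v i) := fun v i =>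
    (hw i).mul ((continuous_apply i).comp (v.continuous.comp (hρ.subtype_mk hρT)))
  set Ψ : C(T, ι → ℝ) → C(T, ι → ℝ) := fun v =>
    ⟨fun p i => Φ (ext v) i p / w i p, continuous_pi fun i =>
      ((hΦ _ (cext v) i).comp continuous_subtype_val).div ((hw i).comp continuous_subtype_val)
        fun p => (hw0 i p).ne'⟩ with hΨ
  have hcontr : ContractingWith ⟨θ, hθ0⟩ Ψ := by
    refine ⟨by exact_mod_cast hθ1, LipschitzWith.of_dist_le_mul fun v v' => ?_⟩
    refine (ContinuousMap.dist_le (by positivity)).2 fun p => (dist_pi_le_iff (by positivity)).2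
      fun i => ?_
    have h := hc (ext v) (ext v') (cext v) (cext v') (dist v v') dist_nonneg
      (fun i p hp => ?_) i p p.2
    · simp only [hΨ, ContinuousMap.coe_mk, Real.dist_eq]
      rw [← sub_div, abs_div, abs_of_pos (hw0 i p), div_le_iff₀ (hw0 i p)]
      exact h
    · simp only [hext]
      rw [← mul_sub, abs_mul, abs_of_pos (hw0 i p), mul_comm]
      refine mul_le_mul_of_nonneg_right ?_ (hw0 i p).le
      rw [← Real.dist_eq]
      exact (dist_le_pi_dist _ _ i).trans (ContinuousMap.dist_apply_le_dist _)
  set v := hcontr.fixedPoint Ψ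
  have hv : Ψ v = v := hcontr.fixedPoint_isFixedPt
  refine ⟨ext v, cext v, fun i p hp => ?_⟩
  have e : (⟨ρ p, hρT p⟩ : T) = ⟨p, hp⟩ := Subtype.ext (hρid p hp)
  have h1 : v ⟨p, hp⟩ i = Φ (ext v) i p / w i p := by
    conv_lhs => rw [← hv]
    rfl
  change w i p * v ⟨ρ p, hρT p⟩ i = _
  rw [e, h1, mul_div_cancel₀ _ (hw0 i p).ne']

/-- Compactness bounds the weighted difference of two fixed points, and applying the contraction
estimate `n` times multiplies this bound by `θ ^ n`. -/
theorem eqOn_of_weighted_contraction (hT : IsCompact T)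
    (hw : ∀ i, Continuous (w i)) (hw0 : ∀ i x, 0 < w i x) (hθ0 : 0 ≤ θ) (hθ1 : θ < 1)
    (hc : ∀ u v, (∀ i, Continuous (u i)) → (∀ i, Continuous (v i)) → ∀ D, 0 ≤ D →
      (∀ i, ∀ p ∈ T, |u i p - v i p| ≤ D * w i p) →
      ∀ i, ∀ p ∈ T, |Φ u i p - Φ v i p| ≤ θ * D * w i p)
    {u v : ι → X → ℝ} (cu : ∀ i, Continuous (u i)) (cv : ∀ i, Continuous (v i))
    (hu : ∀ i, ∀ p ∈ T, u i p = Φ u i p) (hv : ∀ i, ∀ p ∈ T, v i p = Φ v i p) (i : ι) :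
    EqOn (u i) (v i) T := by
  have hb : ∀ i, ∃ B, ∀ p ∈ T, |(u i p - v i p) / w i p| ≤ B := fun i =>
    hT.exists_bound_of_continuousOn
      (((cu i).sub (cv i)).div (hw i) fun p => (hw0 i p).ne').continuousOn
  choose B hB using hb
  have hD : ∀ i, B i ≤ ∑ j, |B j| := fun i =>
    (le_abs_self _).trans (Finset.single_le_sum (f := fun j => |B j|)
      (fun j _ => abs_nonneg _) (Finset.mem_univ i))
  have hD0 : 0 ≤ ∑ j, |B j| := Finset.sum_nonneg fun j _ => abs_nonneg _
  have hn : ∀ n : ℕ, ∀ i, ∀ p ∈ T, |u i p - v i p| ≤ (θ ^ n * ∑ j, |B j|) * w i p := by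
    intro n
    induction n with
    | zero =>
      intro i p hp
      have := (hB i p hp).trans (hD i)
      rw [abs_div, abs_of_pos (hw0 i p), div_le_iff₀ (hw0 i p)] at this
      simpa using this
    | succ n ih =>
      intro i p hp
      rw [hu i p hp, hv i p hp, pow_succ', mul_assoc θ]
      exact hc u v cu cv _ (by positivity) ih i p hp
  intro p hp
  have ht : Tendsto (fun n : ℕ => (θ ^ n * ∑ j, |B j|) * w i p) atTop (𝓝 0) := by
    simpa using ((tendsto_pow_atTop_nhds_zero_of_lt_one hθ0 hθ1).mul_const
      (∑ j, |B j|)).mul_const (w i p)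
  exact sub_eq_zero.1 (abs_nonpos_iff.1 (ge_of_tendsto' ht fun n => hn n i p hp))

end WeightedContraction

/-! ### Characteristics inside the triangle -/

theorem isCompact_triangle : IsCompact triangle := by
  refine (isCompact_Icc.prod isCompact_Icc).of_isClosed_subset
    (s := Icc (0 : ℝ) 1 ×ˢ Icc (0 : ℝ) 1) ?_ fun p hp => ?_
  · exact (isClosed_le continuous_const continuous_snd).inter
      ((isClosed_le continuous_snd continuous_fst).inter
        (isClosed_le continuous_fst continuous_const))
  · exact ⟨⟨hp.1.trans hp.2.1, hp.2.2⟩, hp.1, hp.2.1.trans hp.2.2⟩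

theorem diag_mem_triangle {x : ℝ} (hx : x ∈ Icc (0 : ℝ) 1) : (x, x) ∈ triangle :=
  ⟨hx.1, le_rfl, hx.2⟩

theorem axis_mem_triangle {x : ℝ} (hx : x ∈ Icc (0 : ℝ) 1) : (x, (0 : ℝ)) ∈ triangle :=
  ⟨le_rfl, hx.1, hx.2⟩

theorem horizontal_mem_triangle {p : ℝ × ℝ} (hp : p ∈ triangle) {z : ℝ} (hz : z ∈ Icc p.2 p.1) :
    (z, p.2) ∈ triangle :=
  ⟨hp.1, hz.1, hz.2.trans hp.2.2⟩

section Characteristics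

variable {a : ℝ} {p : ℝ × ℝ}

theorem hatFoot_mem (ha : 0 < a) (ha1 : a ≤ 1) (hp : p ∈ triangle) :
    p.1 - a * p.2 ∈ Icc (0 : ℝ) 1 := by
  obtain ⟨h1, h2, h3⟩ := hp
  have := mul_le_of_le_one_left h1 ha1
  have := mul_nonneg ha.le h1
  constructor <;> linarith

theorem hatFoot_le (ha : 0 < a) (hp : p ∈ triangle) : p.1 - a * p.2 ≤ p.1 := by
  have := mul_nonneg ha.le hp.1
  linarith

theorem diagFoot_le (ha : 0 < a) (hp : p ∈ triangle) : diagFoot a p ≤ p.1 := by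
  rw [diagFoot, div_le_iff₀ (by positivity)]
  nlinarith [mul_le_mul_of_nonneg_left hp.2.1 ha.le]

theorem le_diagFoot (ha : 0 < a) (hp : p ∈ triangle) : p.2 ≤ diagFoot a p := by
  rw [diagFoot, le_div_iff₀ (by positivity)]
  linarith [hp.2.1]

theorem diagFoot_mem (ha : 0 < a) (hp : p ∈ triangle) : diagFoot a p ∈ Icc (0 : ℝ) 1 :=
  ⟨hp.1.trans (le_diagFoot ha hp), (diagFoot_le ha hp).trans hp.2.2⟩

/-- Since 1 / a ≥ 1, the characteristic traced backwards descends at least as fast as the diagonal,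
so it meets the axis without crossing the diagonal. -/
theorem hatChar_mem (ha : 0 < a) (ha1 : a ≤ 1) (hp : p ∈ triangle) {z : ℝ}
    (hz : z ∈ Icc (p.1 - a * p.2) p.1) : (z, p.2 - (p.1 - z) / a) ∈ triangle := by
  have h1 : (p.1 - z) / a ≤ p.2 := by
    rw [div_le_iff₀ ha]
    linarith [hz.1]
  have h2 : p.1 - z ≤ (p.1 - z) / a := by
    rw [le_div_iff₀ ha]
    exact mul_le_of_le_one_right (by linarith [hz.2]) ha1
  have := hp.2.1
  exact ⟨by dsimp only; linarith, by dsimp only; linarith, hz.2.trans hp.2.2⟩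

theorem checkChar_mem (ha : 0 < a) (hp : p ∈ triangle) {z : ℝ}
    (hz : z ∈ Icc (diagFoot a p) p.1) : (z, p.2 + (p.1 - z) / a) ∈ triangle := by
  have h0 : 0 ≤ (p.1 - z) / a := div_nonneg (by linarith [hz.2]) ha.le
  refine ⟨by dsimp only; linarith [hp.1], ?_, hz.2.trans hp.2.2⟩
  have h1 := hz.1
  rw [diagFoot, div_le_iff₀ (by positivity)] at h1
  have : (p.1 - z) / a ≤ z - p.2 := by
    rw [div_le_iff₀ ha]
    linarith
  dsimp only
  linarith

theorem hatInt_congr (ha : 0 < a) (ha1 : a ≤ 1) (hp : p ∈ triangle) {S S' : ℝ × ℝ → ℝ}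
    (h : EqOn S S' triangle) : hatInt a S p = hatInt a S' p := by
  refine intervalIntegral.integral_congr fun z hz => h (hatChar_mem ha ha1 hp ?_)
  rwa [uIcc_of_le (hatFoot_le ha hp)] at hz

theorem checkInt_congr (ha : 0 < a) (hp : p ∈ triangle) {S S' : ℝ × ℝ → ℝ}
    (h : EqOn S S' triangle) : checkInt a S p = checkInt a S' p := by
  refine intervalIntegral.integral_congr fun z hz => h (checkChar_mem ha hp ?_)
  rwa [uIcc_of_le (diagFoot_le ha hp)] at hz

/-- Integrating the exponential weight gains the factor 1 / κ; this is the smallness behind the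
contraction. -/
theorem abs_integral_sub_le_exp {f g : ℝ → ℝ} (hf : Continuous f) (hg : Continuous g)
    {M κ α x : ℝ} (hM : 0 ≤ M) (hκ : 0 < κ) (hα : α ≤ x)
    (h : ∀ z ∈ Icc α x, |f z - g z| ≤ M * Real.exp (κ * z)) :
    |(∫ z in α..x, f z) - ∫ z in α..x, g z| ≤ M / κ * Real.exp (κ * x) := by
  rw [← intervalIntegral.integral_sub (hf.intervalIntegrable _ _) (hg.intervalIntegrable _ _)]
  refine (intervalIntegral.norm_integral_le_of_norm_le (μ := volume)
    (f := fun z => f z - g z) (g := fun z => M * Real.exp (κ * z)) hα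
    (Eventually.of_forall fun z hz => h z (Ioc_subset_Icc_self hz))
    (Continuous.intervalIntegrable (by fun_prop) _ _)).trans ?_
  rw [intervalIntegral.integral_const_mul, intervalIntegral.integral_comp_mul_left _ hκ.ne',
    integral_exp, smul_eq_mul, div_eq_mul_inv, mul_assoc]
  have := Real.exp_pos (κ * α)
  gcongr
  linarith

theorem abs_hatInt_sub_le (ha : 0 < a) (ha1 : a ≤ 1) (hp : p ∈ triangle) {S S' : ℝ × ℝ → ℝ}
    (hS : Continuous S) (hS' : Continuous S') {M κ : ℝ} (hM : 0 ≤ M) (hκ : 0 < κ)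
    (h : ∀ q ∈ triangle, |S q - S' q| ≤ M * Real.exp (κ * q.1)) :
    |hatInt a S p - hatInt a S' p| ≤ M / κ * Real.exp (κ * p.1) :=
  abs_integral_sub_le_exp (by fun_prop) (by fun_prop) hM hκ (hatFoot_le ha hp)
    fun _ hz => h _ (hatChar_mem ha ha1 hp hz)

theorem abs_checkInt_sub_le (ha : 0 < a) (hp : p ∈ triangle) {S S' : ℝ × ℝ → ℝ}
    (hS : Continuous S) (hS' : Continuous S') {M κ : ℝ} (hM : 0 ≤ M) (hκ : 0 < κ)
    (h : ∀ q ∈ triangle, |S q - S' q| ≤ M * Real.exp (κ * q.1)) :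
    |checkInt a S p - checkInt a S' p| ≤ M / κ * Real.exp (κ * p.1) :=
  abs_integral_sub_le_exp (by fun_prop) (by fun_prop) hM hκ (diagFoot_le ha hp)
    fun _ hz => h _ (checkChar_mem ha hp hz)

end Characteristics

/-! ### The system integrated along characteristics -/

/-- The coefficients of the second-row kernel system, with the reaction coefficients
`L₁ = λ₁ + c₂`, `L₂ = λ₂ + c₂` and the sources extended continuously to the whole space. -/
structure Coefficients where
  a : ℝ
  μ : ℝ
  γ : ℝ
  L₁ : ℝ → ℝ
  L₂ : ℝ → ℝ
  k₁ : ℝ × ℝ → ℝ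
  k₂ : ℝ × ℝ → ℝ
  a_pos : 0 < a
  a_le_one : a ≤ 1
  μ_pos : 0 < μ
  cont_L₁ : Continuous L₁
  cont_L₂ : Continuous L₂
  cont_k₁ : Continuous k₁
  cont_k₂ : Continuous k₂

namespace Coefficients

variable (d : Coefficients)

/-- The horizontal integral recovering a kernel from its Riemann invariants. -/
def recover (kh kc : ℝ × ℝ → ℝ) (p : ℝ × ℝ) : ℝ :=
  1 / (2 * d.μ) * ∫ z in p.2..p.1, (kc (z, p.2) + kh (z, p.2))

/-- The right-hand side of the equations for the first pair of invariants. -/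
def source₁ (kh₁ kc₁ : ℝ × ℝ → ℝ) (p : ℝ × ℝ) : ℝ :=
  d.L₁ p.2 * d.recover kh₁ kc₁ p - d.γ * (kc₁ (p.1, p.1) - kh₁ (p.1, p.1)) * d.k₁ p

/-- The right-hand side of the equations for the second pair of invariants. -/
def source₂ (kh₁ kc₁ kh₂ kc₂ : ℝ × ℝ → ℝ) (p : ℝ × ℝ) : ℝ :=
  d.L₂ p.2 * (-(∫ z in (0 : ℝ)..p.2, d.L₂ z / (2 * d.μ ^ 2)) + d.recover kh₂ kc₂ p) -
    d.γ * (kc₁ (p.1, p.1) - kh₁ (p.1, p.1)) * d.k₂ p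

/-- Reflection coefficient at the diagonal. -/
def r : ℝ := (1 - d.a) / (1 + d.a)

/-- Reflection coefficient at the axis. -/
def q : ℝ := (1 - d.a ^ 2) / (1 + d.a ^ 2)

/-- Transmission coefficient at the axis from the second to the first state. -/
def t₁ : ℝ := 2 * d.a ^ 3 / (1 + d.a ^ 2)

/-- Transmission coefficient at the axis from the first to the second state. -/
def t₂ : ℝ := 2 / (d.a * (1 + d.a ^ 2))

/-- Integration of the system along characteristics; the unknowns `u 0`, `u 1`, `u 2`, `u 3` are
the invariants `kh₂₁`, `kh₂₂`, `kc₂₁`, `kc₂₂`. -/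
def picard (u : Fin 4 → ℝ × ℝ → ℝ) : Fin 4 → ℝ × ℝ → ℝ :=
  ![fun p => (-d.q * u 2 (p.1 - d.a * p.2, 0) + d.t₁ * u 3 (p.1 - d.a * p.2, 0)) +
      1 / d.μ * hatInt d.a (d.source₁ (u 0) (u 2)) p,
    fun p => (d.t₂ * u 2 (p.1 - 1 * p.2, 0) + d.q * u 3 (p.1 - 1 * p.2, 0)) +
      1 / d.μ * hatInt 1 (d.source₂ (u 0) (u 2) (u 1) (u 3)) p,
    fun p => -d.r * u 0 (diagFoot d.a p, diagFoot d.a p) +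
      1 / d.μ * checkInt d.a (d.source₁ (u 0) (u 2)) p,
    fun p => -(d.L₂ (diagFoot 1 p) / (2 * d.μ)) +
      1 / d.μ * checkInt 1 (d.source₂ (u 0) (u 2) (u 1) (u 3)) p]

theorem picard_zero (u : Fin 4 → ℝ × ℝ → ℝ) : d.picard u 0 = fun p =>
    (-d.q * u 2 (p.1 - d.a * p.2, 0) + d.t₁ * u 3 (p.1 - d.a * p.2, 0)) +
      1 / d.μ * hatInt d.a (d.source₁ (u 0) (u 2)) p := rfl

theorem picard_one (u : Fin 4 → ℝ × ℝ → ℝ) : d.picard u 1 = fun p =>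
    (d.t₂ * u 2 (p.1 - 1 * p.2, 0) + d.q * u 3 (p.1 - 1 * p.2, 0)) +
      1 / d.μ * hatInt 1 (d.source₂ (u 0) (u 2) (u 1) (u 3)) p := rfl

theorem picard_two (u : Fin 4 → ℝ × ℝ → ℝ) : d.picard u 2 = fun p =>
    -d.r * u 0 (diagFoot d.a p, diagFoot d.a p) +
      1 / d.μ * checkInt d.a (d.source₁ (u 0) (u 2)) p := rfl

theorem picard_three (u : Fin 4 → ℝ × ℝ → ℝ) : d.picard u 3 = fun p =>
    -(d.L₂ (diagFoot 1 p) / (2 * d.μ)) +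
      1 / d.μ * checkInt 1 (d.source₂ (u 0) (u 2) (u 1) (u 3)) p := rfl

theorem continuous_recover {kh kc : ℝ × ℝ → ℝ} (hh : Continuous kh) (hc : Continuous kc) :
    Continuous (d.recover kh kc) := by
  have h := continuous_integral_snd (f := fun p => kc (p.2, p.1) + kh (p.2, p.1)) (by fun_prop)
    continuous_fst continuous_snd
  exact continuous_const.mul (h.comp continuous_swap)

theorem continuous_source₁ {kh₁ kc₁ : ℝ × ℝ → ℝ} (hh : Continuous kh₁) (hc : Continuous kc₁) :
    Continuous (d.source₁ kh₁ kc₁) := by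
  have h1 := d.cont_L₁
  have h2 := d.cont_k₁
  have h3 := d.continuous_recover hh hc
  unfold source₁
  fun_prop

theorem continuous_source₂ {kh₁ kc₁ kh₂ kc₂ : ℝ × ℝ → ℝ} (hh : Continuous kh₁)
    (hc : Continuous kc₁) (hh₂ : Continuous kh₂) (hc₂ : Continuous kc₂) :
    Continuous (d.source₂ kh₁ kc₁ kh₂ kc₂) := by
  have h1 := d.cont_L₂
  have h2 := d.cont_k₂
  have h3 := d.continuous_recover hh₂ hc₂
  have h4 : Continuous fun y => ∫ z in (0 : ℝ)..y, d.L₂ z / (2 * d.μ ^ 2) :=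
    (contDiff_primitive (by fun_prop) 0).continuous
  unfold source₂
  fun_prop

theorem continuous_picard (u : Fin 4 → ℝ × ℝ → ℝ) (hu : ∀ i, Continuous (u i)) (i : Fin 4) :
    Continuous (d.picard u i) := by
  have h0 := hu 0
  have h1 := hu 1
  have h2 := hu 2
  have h3 := hu 3
  have c1 := d.continuous_source₁ h0 h2
  have c2 := d.continuous_source₂ h0 h2 h1 h3
  have hL := d.cont_L₂
  have e1 := continuous_hatInt (a := d.a) c1
  have e2 := continuous_hatInt (a := 1) c2
  have e3 := continuous_checkInt (a := d.a) c1
  have e4 := continuous_checkInt (a := 1) c2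
  have e5 := continuous_diagFoot (a := d.a)
  have e6 := continuous_diagFoot (a := 1)
  match i with
  | 0 => rw [picard_zero]; fun_prop
  | 1 => rw [picard_one]; fun_prop
  | 2 => rw [picard_two]; fun_prop
  | 3 => rw [picard_three]; fun_prop

end Coefficients

/-! ### The contraction estimate -/

namespace Coefficients

variable (d : Coefficients)

theorem r_nonneg : 0 ≤ d.r := by
  have := d.a_pos
  exact div_nonneg (by linarith [d.a_le_one]) (by positivity)

theorem r_lt_one : d.r < 1 := by
  have := d.a_pos
  rw [r, div_lt_one (by positivity)]
  linarith

theorem q_nonneg : 0 ≤ d.q := by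
  have := d.a_pos
  exact div_nonneg (by nlinarith [d.a_le_one]) (by positivity)

theorem q_lt_one : d.q < 1 := by
  have := d.a_pos
  rw [q, div_lt_one (by positivity)]
  nlinarith

theorem t₁_nonneg : 0 ≤ d.t₁ := by
  have := d.a_pos
  unfold t₁
  positivity

theorem t₂_nonneg : 0 ≤ d.t₂ := by
  have := d.a_pos
  unfold t₂
  positivity

theorem q_add_half_t₁_lt_one : d.q + d.t₁ / 2 < 1 := by
  have := d.a_pos
  have h : d.q + d.t₁ / 2 = (1 - d.a ^ 2 + d.a ^ 3) / (1 + d.a ^ 2) := by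
    unfold q t₁
    field_simp
  rw [h, div_lt_one (by positivity)]
  have h2 : 0 < d.a ^ 2 := by positivity
  nlinarith [mul_le_mul_of_nonneg_left d.a_le_one h2.le]

/-- Relative weights of the four invariants for which the reflections contract. -/
def ratio : Fin 4 → ℝ := ![1, d.t₂ + 1, 1, 1 / 2]

/-- The weight, exponential in the evolution variable `x`, for which `picard` contracts. -/
def weight (κ : ℝ) (i : Fin 4) (p : ℝ × ℝ) : ℝ := d.ratio i * Real.exp (κ * p.1)

theorem ratio_pos (i : Fin 4) : 0 < d.ratio i := by
  have := d.t₂_nonneg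
  fin_cases i <;> simp [ratio]
  linarith

theorem weight_pos (κ : ℝ) (i : Fin 4) (p : ℝ × ℝ) : 0 < d.weight κ i p :=
  mul_pos (d.ratio_pos i) (Real.exp_pos _)

theorem continuous_weight (κ : ℝ) (i : Fin 4) : Continuous (d.weight κ i) := by
  unfold weight
  fun_prop

theorem abs_recover_sub_le {kh kc kh' kc' : ℝ × ℝ → ℝ} (h1 : Continuous kh) (h2 : Continuous kc)
    (h3 : Continuous kh') (h4 : Continuous kc') {m n κ : ℝ} (hm : 0 ≤ m) (hn : 0 ≤ n) (hκ : 1 ≤ κ)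
    (hh : ∀ p ∈ triangle, |kh p - kh' p| ≤ m * Real.exp (κ * p.1))
    (hc : ∀ p ∈ triangle, |kc p - kc' p| ≤ n * Real.exp (κ * p.1)) {p : ℝ × ℝ}
    (hp : p ∈ triangle) :
    |d.recover kh kc p - d.recover kh' kc' p| ≤ 1 / (2 * d.μ) * ((m + n) * Real.exp (κ * p.1)) := by
  have hμ := d.μ_pos
  have hκ0 : 0 < κ := by linarith
  unfold recover
  rw [← mul_sub, abs_mul, abs_of_nonneg (by positivity)]
  refine mul_le_mul_of_nonneg_left ?_ (by positivity)
  refine (abs_integral_sub_le_exp (M := m + n) (by fun_prop) (by fun_prop) (by positivity) hκ0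
    hp.2.1 fun z hz => ?_).trans ?_
  · have hz' := horizontal_mem_triangle hp hz
    rw [add_sub_add_comm, add_comm m, add_mul]
    exact (abs_add_le _ _).trans (add_le_add (hc _ hz') (hh _ hz'))
  · exact mul_le_mul_of_nonneg_right (div_le_self (by positivity) hκ) (Real.exp_pos _).le

/-- Lipschitz bound of the sources with respect to the exponentially weighted norm. -/
theorem exists_source_bound : ∃ N : ℝ, 0 ≤ N ∧ ∀ u v : Fin 4 → ℝ × ℝ → ℝ,
    (∀ i, Continuous (u i)) → (∀ i, Continuous (v i)) → ∀ κ, 1 ≤ κ → ∀ D, 0 ≤ D →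
    (∀ i, ∀ p ∈ triangle, |u i p - v i p| ≤ D * d.weight κ i p) → ∀ p ∈ triangle,
      |d.source₁ (u 0) (u 2) p - d.source₁ (v 0) (v 2) p| ≤ N * D * Real.exp (κ * p.1) ∧
      |d.source₂ (u 0) (u 2) (u 1) (u 3) p - d.source₂ (v 0) (v 2) (v 1) (v 3) p| ≤
        N * D * Real.exp (κ * p.1) := by
  obtain ⟨A₁, hA₁⟩ := isCompact_Icc.exists_bound_of_continuousOn (s := Icc (0 : ℝ) 1)
    d.cont_L₁.continuousOn
  obtain ⟨A₂, hA₂⟩ := isCompact_Icc.exists_bound_of_continuousOn (s := Icc (0 : ℝ) 1)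
    d.cont_L₂.continuousOn
  obtain ⟨B₁, hB₁⟩ := isCompact_triangle.exists_bound_of_continuousOn d.cont_k₁.continuousOn
  obtain ⟨B₂, hB₂⟩ := isCompact_triangle.exists_bound_of_continuousOn d.cont_k₂.continuousOn
  have hμ := d.μ_pos
  have ht := d.t₂_nonneg
  set A := max (max A₁ A₂) 0
  set B := max (max B₁ B₂) 0
  have hA0 : 0 ≤ A := le_max_right _ _
  have hB0 : 0 ≤ B := le_max_right _ _
  -- `d.t₂ + 2` dominates both relevant sums of relative weights: 1 + 1 for the first pair and
  -- (`d.t₂` + 1) + 1 / 2 for the second.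
  set N := A * (1 / (2 * d.μ) * (d.t₂ + 2)) + |d.γ| * 2 * B
  refine ⟨N, by positivity, fun u v hu hv κ hκ D hD h p hp => ?_⟩
  have hy : p.2 ∈ Icc (0 : ℝ) 1 := ⟨hp.1, hp.2.1.trans hp.2.2⟩
  have hx : p.1 ∈ Icc (0 : ℝ) 1 := ⟨hp.1.trans hp.2.1, hp.2.2⟩
  have w0 : ∀ q ∈ triangle, |u 0 q - v 0 q| ≤ D * Real.exp (κ * q.1) := fun q hq => by
    simpa [weight, ratio] using h 0 q hq
  have w1 : ∀ q ∈ triangle, |u 1 q - v 1 q| ≤ D * (d.t₂ + 1) * Real.exp (κ * q.1) := fun q hq => by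
    simpa [weight, ratio, mul_assoc] using h 1 q hq
  have w2 : ∀ q ∈ triangle, |u 2 q - v 2 q| ≤ D * Real.exp (κ * q.1) := fun q hq => by
    simpa [weight, ratio] using h 2 q hq
  have w3 : ∀ q ∈ triangle, |u 3 q - v 3 q| ≤ D * (1 / 2) * Real.exp (κ * q.1) := fun q hq => by
    simpa [weight, ratio, mul_assoc] using h 3 q hq
  have r1 := d.abs_recover_sub_le (hu 0) (hu 2) (hv 0) (hv 2) hD hD hκ w0 w2 hp
  have r2 := d.abs_recover_sub_le (hu 1) (hu 3) (hv 1) (hv 3) (by positivity) (by positivity)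
    hκ w1 w3 hp
  set E := Real.exp (κ * p.1)
  have hE : 0 < E := Real.exp_pos _
  have r1' : |d.recover (u 0) (u 2) p - d.recover (v 0) (v 2) p| ≤
      1 / (2 * d.μ) * (d.t₂ + 2) * (D * E) := by
    refine r1.trans ?_
    rw [mul_assoc]
    refine mul_le_mul_of_nonneg_left ?_ (by positivity)
    nlinarith [mul_nonneg ht (mul_nonneg hD hE.le)]
  have r2' : |d.recover (u 1) (u 3) p - d.recover (v 1) (v 3) p| ≤
      1 / (2 * d.μ) * (d.t₂ + 2) * (D * E) := by
    refine r2.trans ?_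
    rw [mul_assoc]
    refine mul_le_mul_of_nonneg_left ?_ (by positivity)
    nlinarith [mul_nonneg hD hE.le]
  have g : |(u 2 (p.1, p.1) - u 0 (p.1, p.1)) - (v 2 (p.1, p.1) - v 0 (p.1, p.1))| ≤
      2 * (D * E) := by
    have e0 := w0 _ (diag_mem_triangle hx)
    have e2 := w2 _ (diag_mem_triangle hx)
    rw [sub_sub_sub_comm]
    refine (abs_sub _ _).trans ?_
    simp only at e0 e2
    linarith
  have core : ∀ {L K K' k : ℝ}, |L| ≤ A → |k| ≤ B →
      |K - K'| ≤ 1 / (2 * d.μ) * (d.t₂ + 2) * (D * E) →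
      |(L * K - d.γ * (u 2 (p.1, p.1) - u 0 (p.1, p.1)) * k) -
        (L * K' - d.γ * (v 2 (p.1, p.1) - v 0 (p.1, p.1)) * k)| ≤ N * D * E := by
    intro L K K' k hL hk hK
    rw [show (L * K - d.γ * (u 2 (p.1, p.1) - u 0 (p.1, p.1)) * k) -
        (L * K' - d.γ * (v 2 (p.1, p.1) - v 0 (p.1, p.1)) * k) = L * (K - K') - d.γ *
      ((u 2 (p.1, p.1) - u 0 (p.1, p.1)) - (v 2 (p.1, p.1) - v 0 (p.1, p.1))) * k by ring]
    refine (abs_sub _ _).trans ?_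
    rw [abs_mul, abs_mul, abs_mul]
    calc _ ≤ A * (1 / (2 * d.μ) * (d.t₂ + 2) * (D * E)) + |d.γ| * (2 * (D * E)) * B := by gcongr
      _ = N * D * E := by ring
  constructor
  · exact core ((hA₁ _ hy).trans (le_max_of_le_left (le_max_left _ _)))
      ((hB₁ _ hp).trans (le_max_of_le_left (le_max_left _ _))) r1'
  · refine core ((hA₂ _ hy).trans (le_max_of_le_left (le_max_right _ _)))
      ((hB₂ _ hp).trans (le_max_of_le_left (le_max_right _ _))) ?_
    rwa [add_sub_add_left_eq_sub]

/-- These inequalities are what dictates `ratio`. The weight 1 / 2 of kc₂₂ halves the contribution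
of `t₁`, and the weight `t₂` + 1 of kh₂₂ absorbs the possibly large `t₂`. The fourth component needs
no condition, its boundary datum being prescribed. -/
theorem exists_reflection_bound : ∃ θ : ℝ, 0 ≤ θ ∧ θ < 1 ∧ d.q + d.t₁ / 2 ≤ θ ∧
    d.t₂ + d.q / 2 ≤ θ * (d.t₂ + 1) ∧ d.r ≤ θ := by
  have ht := d.t₂_nonneg
  have hq := d.q_lt_one
  refine ⟨max (d.q + d.t₁ / 2) (max ((d.t₂ + d.q / 2) / (d.t₂ + 1)) d.r), ?_, ?_, le_max_left _ _,
    ?_, le_max_of_le_right (le_max_right _ _)⟩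
  · exact le_max_of_le_right (le_max_of_le_right d.r_nonneg)
  · refine max_lt d.q_add_half_t₁_lt_one (max_lt ?_ d.r_lt_one)
    rw [div_lt_one (by positivity)]
    linarith
  · rw [← div_le_iff₀ (by positivity)]
    exact le_max_of_le_right (le_max_left _ _)

theorem exists_picard_contraction : ∃ κ θ : ℝ, 0 ≤ θ ∧ θ < 1 ∧ ∀ u v : Fin 4 → ℝ × ℝ → ℝ,
    (∀ i, Continuous (u i)) → (∀ i, Continuous (v i)) → ∀ D, 0 ≤ D →
    (∀ i, ∀ p ∈ triangle, |u i p - v i p| ≤ D * d.weight κ i p) →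
    ∀ i, ∀ p ∈ triangle, |d.picard u i p - d.picard v i p| ≤ θ * D * d.weight κ i p := by
  obtain ⟨N, hN, hNb⟩ := d.exists_source_bound
  obtain ⟨θ₀, hθ0, hθ1, hq, ht, hr⟩ := d.exists_reflection_bound
  have hμ := d.μ_pos
  have ha := d.a_pos
  have ha1 := d.a_le_one
  have hη : 0 < (1 - θ₀) / 4 := by linarith
  -- Chosen so that the integral terms cost at most a quarter of the gap `1 - θ₀`, leaving the rate
  -- `(1 + θ₀) / 2`. The summand 1 gives `1 ≤ κ`, as `hNb` requires.
  set κ := N / (d.μ * ((1 - θ₀) / 4)) + 1 with hκdef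
  have hκ1 : 1 ≤ κ := by
    rw [hκdef]
    have : 0 ≤ N / (d.μ * ((1 - θ₀) / 4)) := by positivity
    linarith
  have hκ0 : 0 < κ := by linarith
  have hκN : 1 / d.μ * (N / κ) ≤ (1 - θ₀) / 4 := by
    rw [one_div_mul_eq_div, div_div, div_le_iff₀ (by positivity)]
    have : κ * (d.μ * ((1 - θ₀) / 4)) = N + d.μ * ((1 - θ₀) / 4) := by
      rw [hκdef, add_mul, one_mul, div_mul_cancel₀ _ (mul_pos hμ hη).ne']
    nlinarith [mul_pos hμ hη]
  refine ⟨κ, (1 + θ₀) / 2, by linarith, by linarith, fun u v hu hv D hD h i p hp => ?_⟩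
  have hx0 := hatFoot_mem ha ha1 hp
  have hx1 := hatFoot_mem one_pos le_rfl hp
  have hs := diagFoot_mem ha hp
  have hsrc := hNb u v hu hv κ hκ1 D hD h
  set E := Real.exp (κ * p.1) with hE
  have hE0 : 0 < E := Real.exp_pos _
  have hDE : 0 ≤ D * E := by positivity
  -- The feet of the characteristics through `p` lie at abscissae at most `p.1`, so passing to the
  -- boundary does not increase the weight.
  have mono : ∀ x, x ≤ p.1 → ∀ c, 0 ≤ c → D * (c * Real.exp (κ * x)) ≤ c * (D * E) := by
    intro x hx c hc
    rw [mul_left_comm]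
    exact mul_le_mul_of_nonneg_left (mul_le_mul_of_nonneg_left
      (Real.exp_le_exp.2 (mul_le_mul_of_nonneg_left hx hκ0.le)) hD) hc
  have w0 : ∀ x, x ∈ Icc (0 : ℝ) 1 → x ≤ p.1 → |u 0 (x, x) - v 0 (x, x)| ≤ 1 * (D * E) :=
    fun x hx hxp => (h 0 _ (diag_mem_triangle hx)).trans (mono x hxp _ (d.ratio_pos 0).le)
  have w2 : ∀ x, x ∈ Icc (0 : ℝ) 1 → x ≤ p.1 → |u 2 (x, 0) - v 2 (x, 0)| ≤ 1 * (D * E) :=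
    fun x hx hxp => (h 2 _ (axis_mem_triangle hx)).trans (mono x hxp _ (d.ratio_pos 2).le)
  have w3 : ∀ x, x ∈ Icc (0 : ℝ) 1 → x ≤ p.1 → |u 3 (x, 0) - v 3 (x, 0)| ≤ 1 / 2 * (D * E) :=
    fun x hx hxp => (h 3 _ (axis_mem_triangle hx)).trans (mono x hxp _ (d.ratio_pos 3).le)
  have int : ∀ {I J : ℝ}, |I - J| ≤ N * D / κ * E →
      |1 / d.μ * I - 1 / d.μ * J| ≤ (1 - θ₀) / 4 * (D * E) := by
    intro I J hIJ
    rw [← mul_sub, abs_mul, abs_of_pos (by positivity : 0 < 1 / d.μ)]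
    calc 1 / d.μ * |I - J| ≤ 1 / d.μ * (N * D / κ * E) := by gcongr
      _ = 1 / d.μ * (N / κ) * (D * E) := by ring
      _ ≤ _ := by gcongr
  have s1 := d.continuous_source₁ (hu 0) (hu 2)
  have s1' := d.continuous_source₁ (hv 0) (hv 2)
  have s2 := d.continuous_source₂ (hu 0) (hu 2) (hu 1) (hu 3)
  have s2' := d.continuous_source₂ (hv 0) (hv 2) (hv 1) (hv 3)
  have hND : 0 ≤ N * D := by positivity
  have qn := d.q_nonneg
  have t1n := d.t₁_nonneg
  have t2n := d.t₂_nonneg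
  have rn := d.r_nonneg
  match i with
  | 0 =>
    have b2 := w2 _ hx0 (hatFoot_le ha hp)
    have b3 := w3 _ hx0 (hatFoot_le ha hp)
    have b := int (abs_hatInt_sub_le ha ha1 hp s1 s1' hND hκ0 fun q hq => (hsrc q hq).1)
    simp only [picard_zero]
    rw [add_sub_add_comm, add_sub_add_comm, ← mul_sub, ← mul_sub]
    refine (abs_add_three _ _ _).trans ?_
    rw [abs_mul, abs_mul, abs_neg, abs_of_nonneg qn, abs_of_nonneg t1n]
    calc _ ≤ d.q * (1 * (D * E)) + d.t₁ * (1 / 2 * (D * E)) + (1 - θ₀) / 4 * (D * E) := by gcongr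
      _ = (d.q + d.t₁ / 2 + (1 - θ₀) / 4) * (D * E) := by ring
      _ ≤ (1 + θ₀) / 2 * (D * E) := by
        refine mul_le_mul_of_nonneg_right ?_ hDE
        linarith
      _ = (1 + θ₀) / 2 * D * d.weight κ 0 p := by simp [weight, ratio, hE]; ring
  | 1 =>
    have b2 := w2 _ hx1 (hatFoot_le one_pos hp)
    have b3 := w3 _ hx1 (hatFoot_le one_pos hp)
    have b := int (abs_hatInt_sub_le one_pos le_rfl hp s2 s2' hND hκ0 fun q hq => (hsrc q hq).2)
    simp only [picard_one]
    rw [add_sub_add_comm, add_sub_add_comm, ← mul_sub, ← mul_sub]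
    refine (abs_add_three _ _ _).trans ?_
    rw [abs_mul, abs_mul, abs_of_nonneg qn, abs_of_nonneg t2n]
    calc _ ≤ d.t₂ * (1 * (D * E)) + d.q * (1 / 2 * (D * E)) + (1 - θ₀) / 4 * (D * E) := by gcongr
      _ = (d.t₂ + d.q / 2 + (1 - θ₀) / 4) * (D * E) := by ring
      _ ≤ (1 + θ₀) / 2 * (d.t₂ + 1) * (D * E) := by
        refine mul_le_mul_of_nonneg_right ?_ hDE
        nlinarith
      _ = (1 + θ₀) / 2 * D * d.weight κ 1 p := by simp [weight, ratio, hE]; ring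
  | 2 =>
    have b0 := w0 _ hs (diagFoot_le ha hp)
    have b := int (abs_checkInt_sub_le ha hp s1 s1' hND hκ0 fun q hq => (hsrc q hq).1)
    simp only [picard_two]
    rw [add_sub_add_comm, ← mul_sub]
    refine (abs_add_le _ _).trans ?_
    rw [abs_mul, abs_neg, abs_of_nonneg rn]
    calc _ ≤ d.r * (1 * (D * E)) + (1 - θ₀) / 4 * (D * E) := by gcongr
      _ = (d.r + (1 - θ₀) / 4) * (D * E) := by ring
      _ ≤ (1 + θ₀) / 2 * (D * E) := by
        refine mul_le_mul_of_nonneg_right ?_ hDE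
        linarith
      _ = (1 + θ₀) / 2 * D * d.weight κ 2 p := by simp [weight, ratio, hE]; ring
  | 3 =>
    have b := int (abs_checkInt_sub_le one_pos hp s2 s2' hND hκ0 fun q hq => (hsrc q hq).2)
    simp only [picard_three]
    rw [add_sub_add_left_eq_sub]
    calc _ ≤ (1 - θ₀) / 4 * (D * E) := b
      _ ≤ (1 + θ₀) / 2 * (1 / 2) * (D * E) := by
        refine mul_le_mul_of_nonneg_right ?_ hDE
        linarith
      _ = (1 + θ₀) / 2 * D * d.weight κ 3 p := by simp [weight, ratio, hE]; ring

theorem exists_picard_fixedPoint : ∃ u : Fin 4 → ℝ × ℝ → ℝ, (∀ i, Continuous (u i)) ∧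
    ∀ i, ∀ p ∈ triangle, u i p = d.picard u i p := by
  obtain ⟨κ, θ, hθ0, hθ1, h⟩ := d.exists_picard_contraction
  refine exists_fixedPoint_of_weighted_contraction isCompact_triangle
    (continuous_sectorRetract 0 1) (fun p => ?_) (fun p hp => ?_) d.continuous_picard
    (d.continuous_weight κ) (d.weight_pos κ) hθ0 hθ1 h
  · rw [triangle_eq_sector]
    exact sectorRetract_mem zero_le_one p
  · rw [triangle_eq_sector] at hp
    exact sectorRetract_of_mem hp

theorem picard_fixedPoint_unique {u v : Fin 4 → ℝ × ℝ → ℝ} (hu : ∀ i, Continuous (u i))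
    (hv : ∀ i, Continuous (v i)) (eu : ∀ i, ∀ p ∈ triangle, u i p = d.picard u i p)
    (ev : ∀ i, ∀ p ∈ triangle, v i p = d.picard v i p) (i : Fin 4) :
    EqOn (u i) (v i) triangle := by
  obtain ⟨κ, θ, hθ0, hθ1, h⟩ := d.exists_picard_contraction
  exact eqOn_of_weighted_contraction isCompact_triangle (d.continuous_weight κ) (d.weight_pos κ)
    hθ0 hθ1 h hu hv eu ev i

end Coefficients

/-! ### Transported functions and their potentials -/

theorem fderiv_apply_eq_of_hasDerivAt {f : ℝ × ℝ → ℝ} (hf : ContDiff ℝ 1 f) {p v : ℝ × ℝ} {c : ℝ}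
    (h : HasDerivAt (fun τ : ℝ => f (p.1 + v.1 * τ, p.2 + v.2 * τ)) c 0) : fderiv ℝ f p v = c := by
  have h1 : HasFDerivAt f (fderiv ℝ f p) (p.1 + v.1 * 0, p.2 + v.2 * 0) := by
    simpa using (hf.differentiable one_ne_zero p).hasFDerivAt
  have h2 : HasDerivAt (fun τ : ℝ => (p.1 + v.1 * τ, p.2 + v.2 * τ)) (v.1 * 1, v.2 * 1) 0 :=
    (((hasDerivAt_id (0 : ℝ)).const_mul v.1).const_add p.1).prodMk
      (((hasDerivAt_id (0 : ℝ)).const_mul v.2).const_add p.2)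
  have h3 := (h1.comp_hasDerivAt (x := (0 : ℝ)) h2).unique h
  simpa using h3

section Transport

variable {a μ : ℝ} {H : ℝ → ℝ} {S Sy : ℝ × ℝ → ℝ}

theorem contDiff_hat_transport (hH : ContDiff ℝ 1 H) (hS : RegularAlong a⁻¹ S Sy) :
    ContDiff ℝ 1 fun p : ℝ × ℝ => H (p.1 - a * p.2) + 1 / μ * hatInt a S p := by
  have := contDiff_hatInt hS
  fun_prop

theorem contDiff_check_transport (hH : ContDiff ℝ 1 H) (hS : RegularAlong (-a⁻¹) S Sy) :
    ContDiff ℝ 1 fun p : ℝ × ℝ => H (diagFoot a p) + 1 / μ * checkInt a S p := by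
  have := contDiff_checkInt hS
  have := contDiff_diagFoot (a := a) (n := 1)
  fun_prop

theorem fderiv_hat_transport (ha : 0 < a) (hH : ContDiff ℝ 1 H) (hS : RegularAlong a⁻¹ S Sy)
    (p : ℝ × ℝ) :
    fderiv ℝ (fun p : ℝ × ℝ => H (p.1 - a * p.2) + 1 / μ * hatInt a S p) p (a, 1) =
      1 / μ * (a * S p) := by
  refine fderiv_apply_eq_of_hasDerivAt (contDiff_hat_transport hH hS) ?_
  have h := ((hasDerivAt_hatInt_char ha hS.cont p).const_mul (1 / μ)).const_add (H (p.1 - a * p.2))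
  refine (h.congr_deriv rfl).congr_of_eventuallyEq (Eventually.of_forall fun τ => ?_)
  have e : p.1 + a * τ - a * (p.2 + τ) = p.1 - a * p.2 := by ring
  simp only [one_mul, e]

theorem fderiv_check_transport (ha : 0 < a) (hH : ContDiff ℝ 1 H)
    (hS : RegularAlong (-a⁻¹) S Sy) (p : ℝ × ℝ) :
    fderiv ℝ (fun p : ℝ × ℝ => H (diagFoot a p) + 1 / μ * checkInt a S p) p (a, -1) =
      1 / μ * (a * S p) := by
  refine fderiv_apply_eq_of_hasDerivAt (contDiff_check_transport hH hS) ?_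
  have h := ((hasDerivAt_checkInt_char ha hS.cont p).const_mul (1 / μ)).const_add (H (diagFoot a p))
  refine (h.congr_deriv rfl).congr_of_eventuallyEq (Eventually.of_forall fun τ => ?_)
  have e : diagFoot a (p.1 + a * τ, p.2 - τ) = diagFoot a p := by
    simp only [diagFoot]
    congr 1
    ring
  simp only [neg_one_mul, ← sub_eq_add_neg, e]

end Transport

section Potential

variable {a : ℝ} {W kh kc : ℝ × ℝ → ℝ}

theorem contDiff_one_of_potential
    (hW : ∀ p, HasFDerivAt W (planeForm (kh p + kc p) (a * (kc p - kh p))) p)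
    (ch : Continuous kh) (cc : Continuous kc) : ContDiff ℝ 1 W :=
  contDiff_one_iff_hasFDerivAt.2 ⟨_, continuous_planeForm (u := fun p => kh p + kc p)
    (v := fun p => a * (kc p - kh p)) (by fun_prop) (by fun_prop), hW⟩

theorem contDiff_two_of_potential
    (hW : ∀ p, HasFDerivAt W (planeForm (kh p + kc p) (a * (kc p - kh p))) p)
    (ch : ContDiff ℝ 1 kh) (cc : ContDiff ℝ 1 kc) : ContDiff ℝ 2 W := by
  have := (contDiff_succ_iff_hasFDerivAt (𝕜 := ℝ) (n := 1) (f := W)).2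
    ⟨_, contDiff_planeForm (u := fun p => kh p + kc p) (v := fun p => a * (kc p - kh p))
      (ch.add cc) (contDiff_const.mul (cc.sub ch)), hW⟩
  simpa [one_add_one_eq_two] using this

theorem integral_horizontal_of_potential
    (hW : ∀ p, HasFDerivAt W (planeForm (kh p + kc p) (a * (kc p - kh p))) p)
    (ch : Continuous kh) (cc : Continuous kc) (p : ℝ × ℝ) :
    ∫ z in p.2..p.1, (kc (z, p.2) + kh (z, p.2)) = W p - W (p.2, p.2) := by
  refine intervalIntegral.integral_eq_sub_of_hasDerivAt (f := fun z => W (z, p.2)) (fun z _ => ?_)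
    (Continuous.intervalIntegrable (by fun_prop) _ _)
  refine ((hW (z, p.2)).comp_hasDerivAt z
    ((hasDerivAt_id z).prodMk (hasDerivAt_const z p.2))).congr_deriv ?_
  simp
  ring

theorem integral_diag_of_potential
    (hW : ∀ p, HasFDerivAt W (planeForm (kh p + kc p) (a * (kc p - kh p))) p)
    (ch : Continuous kh) (cc : Continuous kc) (y : ℝ) :
    ∫ t in (0 : ℝ)..y, ((1 + a) * kc (t, t) + (1 - a) * kh (t, t)) = W (y, y) - W (0, 0) := by
  refine intervalIntegral.integral_eq_sub_of_hasDerivAt (f := fun t => W (t, t)) (fun t _ => ?_)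
    (Continuous.intervalIntegrable (by fun_prop) _ _)
  refine ((hW (t, t)).comp_hasDerivAt (f := fun t => (t, t)) t ((hasDerivAt_id t).prodMk (hasDerivAt_id t))).congr_deriv ?_
  simp
  ring

end Potential

/-! ### Regularity of the continuous fixed point -/

namespace Coefficients

variable (d : Coefficients)

theorem recover_congr {kh kc kh' kc' : ℝ × ℝ → ℝ} (hh : EqOn kh kh' triangle)
    (hc : EqOn kc kc' triangle) {p : ℝ × ℝ} (hp : p ∈ triangle) :
    d.recover kh kc p = d.recover kh' kc' p := by
  unfold recover
  congr 1
  refine intervalIntegral.integral_congr fun z hz => ?_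
  rw [uIcc_of_le hp.2.1] at hz
  have hz' := horizontal_mem_triangle hp hz
  simp only [hh hz', hc hz']

theorem source₁_congr {kh kc kh' kc' : ℝ × ℝ → ℝ} (hh : EqOn kh kh' triangle)
    (hc : EqOn kc kc' triangle) : EqOn (d.source₁ kh kc) (d.source₁ kh' kc') triangle := by
  intro p hp
  have hd := diag_mem_triangle (x := p.1) ⟨hp.1.trans hp.2.1, hp.2.2⟩
  simp only [source₁, d.recover_congr hh hc hp, hh hd, hc hd]

theorem source₂_congr {kh kc kh' kc' lh lc lh' lc' : ℝ × ℝ → ℝ} (hh : EqOn kh kh' triangle)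
    (hc : EqOn kc kc' triangle) (lhh : EqOn lh lh' triangle) (lcc : EqOn lc lc' triangle) :
    EqOn (d.source₂ kh kc lh lc) (d.source₂ kh' kc' lh' lc') triangle := by
  intro p hp
  have hd := diag_mem_triangle (x := p.1) ⟨hp.1.trans hp.2.1, hp.2.2⟩
  simp only [source₂, d.recover_congr lhh lcc hp, hh hd, hc hd]

/-- The horizontal integral starts on the diagonal, where the derivative of `W` is (1 + a) kc + (1 -
a) kh. The reflection condition makes this vanish, so `W` is constant there. -/
theorem recover_of_potential₁ {W kh kc : ℝ × ℝ → ℝ}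
    (hW : ∀ p, HasFDerivAt W (planeForm (kh p + kc p) (d.a * (kc p - kh p))) p)
    (ch : Continuous kh) (cc : Continuous kc)
    (hdiag : ∀ x ∈ Icc (0 : ℝ) 1, kc (x, x) = -d.r * kh (x, x)) {p : ℝ × ℝ} (hp : p ∈ triangle) :
    d.recover kh kc p = 1 / (2 * d.μ) * (W p - W (0, 0)) := by
  have h1 := integral_diag_of_potential hW ch cc p.2
  have h2 : ∫ t in (0 : ℝ)..p.2, ((1 + d.a) * kc (t, t) + (1 - d.a) * kh (t, t)) =
      ∫ t in (0 : ℝ)..p.2, (0 : ℝ) := by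
    refine intervalIntegral.integral_congr fun t ht => ?_
    rw [uIcc_of_le hp.1] at ht
    have ha : 1 + d.a ≠ 0 := by
      have := d.a_pos
      positivity
    simp only [hdiag t ⟨ht.1, ht.2.trans (hp.2.1.trans hp.2.2)⟩, r]
    field_simp
    ring
  rw [h2, intervalIntegral.integral_zero] at h1
  unfold recover
  rw [integral_horizontal_of_potential hW ch cc]
  congr 1
  linarith

/-- Here the derivative of `W` along the diagonal is 2 kc, known from the boundary condition; its
integral accounts exactly for the additional reaction term. -/
theorem recover_of_potential₂ {W kh kc : ℝ × ℝ → ℝ}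
    (hW : ∀ p, HasFDerivAt W (planeForm (kh p + kc p) (1 * (kc p - kh p))) p)
    (ch : Continuous kh) (cc : Continuous kc)
    (hdiag : ∀ x ∈ Icc (0 : ℝ) 1, kc (x, x) = -(d.L₂ x / (2 * d.μ))) {p : ℝ × ℝ}
    (hp : p ∈ triangle) :
    -(∫ z in (0 : ℝ)..p.2, d.L₂ z / (2 * d.μ ^ 2)) + d.recover kh kc p =
      1 / (2 * d.μ) * (W p - W (0, 0)) := by
  have hμ := d.μ_pos
  have h1 := integral_diag_of_potential hW ch cc p.2
  have h2 : ∫ t in (0 : ℝ)..p.2, ((1 + 1) * kc (t, t) + (1 - 1) * kh (t, t)) =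
      ∫ t in (0 : ℝ)..p.2, -(2 * d.μ) * (d.L₂ t / (2 * d.μ ^ 2)) := by
    refine intervalIntegral.integral_congr fun t ht => ?_
    rw [uIcc_of_le hp.1] at ht
    simp only [hdiag t ⟨ht.1, ht.2.trans (hp.2.1.trans hp.2.2)⟩]
    field_simp
    ring
  rw [h2, intervalIntegral.integral_const_mul] at h1
  unfold recover
  rw [integral_horizontal_of_potential hW ch cc, show W (p.2, p.2) = W (0, 0) +
    -(2 * d.μ) * ∫ t in (0 : ℝ)..p.2, d.L₂ t / (2 * d.μ ^ 2) by linarith]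
  field_simp
  ring

/-- The continuous fixed point of the characteristic integration is continuously differentiable. -/
theorem exists_contDiff_of_picard_fixedPoint (hL₁ : ContDiff ℝ 1 d.L₁) (hL₂ : ContDiff ℝ 1 d.L₂)
    {k₁y k₂y : ℝ × ℝ → ℝ} (hk₁ : RegularAlong d.a⁻¹ d.k₁ k₁y)
    (hk₁' : RegularAlong (-d.a⁻¹) d.k₁ k₁y) (hk₂ : RegularAlong 1⁻¹ d.k₂ k₂y)
    (hk₂' : RegularAlong (-1⁻¹) d.k₂ k₂y) {u : Fin 4 → ℝ × ℝ → ℝ} (hu : ∀ i, Continuous (u i))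
    (eu : ∀ i, ∀ p ∈ triangle, u i p = d.picard u i p) :
    ∃ (v : Fin 4 → ℝ × ℝ → ℝ) (W₁ W₂ : ℝ × ℝ → ℝ), (∀ i, ContDiff ℝ 1 (v i)) ∧
      (∀ i, EqOn (v i) (u i) triangle) ∧
      (∀ p, HasFDerivAt W₁ (planeForm (v 0 p + v 2 p) (d.a * (v 2 p - v 0 p))) p) ∧
      (∀ p, HasFDerivAt W₂ (planeForm (v 1 p + v 3 p) (1 * (v 3 p - v 1 p))) p) ∧
      ∀ p ∈ triangle,
        fderiv ℝ (v 0) p (d.a, 1) = 1 / d.μ * (d.a * d.source₁ (v 0) (v 2) p) ∧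
        fderiv ℝ (v 1) p (1, 1) = 1 / d.μ * (1 * d.source₂ (v 0) (v 2) (v 1) (v 3) p) ∧
        fderiv ℝ (v 2) p (d.a, -1) = 1 / d.μ * (d.a * d.source₁ (v 0) (v 2) p) ∧
        fderiv ℝ (v 3) p (1, -1) = 1 / d.μ * (1 * d.source₂ (v 0) (v 2) (v 1) (v 3) p) := by
  have ha := d.a_pos
  have ha1 := d.a_le_one
  have hu0 := hu 0
  have hu1 := hu 1
  have hu2 := hu 2
  have hu3 := hu 3
  have cL₂ := d.cont_L₂
  have cP := d.continuous_picard u hu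
  have eP : ∀ i, EqOn (u i) (d.picard u i) triangle := fun i p hp => eu i p hp
  have diag₁ : ∀ x ∈ Icc (0 : ℝ) 1, u 2 (x, x) = -d.r * u 0 (x, x) := fun x hx => by
    rw [eu 2 _ (diag_mem_triangle hx), picard_two]
    simp [checkInt_diag ha, diagFoot_diag ha]
  have diag₂ : ∀ x ∈ Icc (0 : ℝ) 1, u 3 (x, x) = -(d.L₂ x / (2 * d.μ)) := fun x hx => by
    rw [eu 3 _ (diag_mem_triangle hx), picard_three]
    simp [checkInt_diag one_pos, diagFoot_diag one_pos]
  obtain ⟨V₁, hV₁⟩ := exists_potential (μ := d.μ) (kh := d.picard u 0) (kc := d.picard u 2) ha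
    (H := fun x => -d.q * u 2 (x, 0) + d.t₁ * u 3 (x, 0)) (C := fun x => -d.r * u 0 (x, x))
    (by fun_prop) (by fun_prop) (d.continuous_source₁ hu0 hu2) (fun _ => rfl) (fun _ => rfl)
  obtain ⟨V₂, hV₂⟩ := exists_potential (μ := d.μ) (kh := d.picard u 1) (kc := d.picard u 3) one_pos
    (H := fun x => d.t₂ * u 2 (x, 0) + d.q * u 3 (x, 0)) (C := fun x => -(d.L₂ x / (2 * d.μ)))
    (by fun_prop) (by fun_prop) (d.continuous_source₂ hu0 hu2 hu1 hu3) (fun _ => rfl)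
    (fun _ => rfl)
  have cV₁ := contDiff_one_of_potential hV₁ (cP 0) (cP 2)
  have cV₂ := contDiff_one_of_potential hV₂ (cP 1) (cP 3)
  set K₁ : ℝ × ℝ → ℝ := fun p => 1 / (2 * d.μ) * (V₁ p - V₁ (0, 0)) with hK₁
  set K₂ : ℝ × ℝ → ℝ := fun p => 1 / (2 * d.μ) * (V₂ p - V₂ (0, 0)) with hK₂
  have cK₁ : ContDiff ℝ 1 fun p : ℝ × ℝ => d.L₁ p.2 * K₁ p := by fun_prop
  have cK₂ : ContDiff ℝ 1 fun p : ℝ × ℝ => d.L₂ p.2 * K₂ p := by fun_prop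
  -- The trace coupling is constant in y, so its y-derivative is 0 although `u` is merely
  -- continuous.
  have rg : ∀ m, RegularAlong m (fun p : ℝ × ℝ => d.γ * (u 2 (p.1, p.1) - u 0 (p.1, p.1)))
      (fun _ => 0) := fun m => .of_continuous (by fun_prop) continuous_const
    fun p => hasDerivAt_const p.2 (d.γ * (u 2 (p.1, p.1) - u 0 (p.1, p.1)))
  have rS₁ := fun {m : ℝ} (h : RegularAlong m d.k₁ k₁y) => (RegularAlong.of_contDiff cK₁).sub
    ((rg m).mul h)
  have rS₂ := fun {m : ℝ} (h : RegularAlong m d.k₂ k₂y) => (RegularAlong.of_contDiff cK₂).sub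
    ((rg m).mul h)
  set S₁ : ℝ × ℝ → ℝ := fun p =>
    d.L₁ p.2 * K₁ p - d.γ * (u 2 (p.1, p.1) - u 0 (p.1, p.1)) * d.k₁ p with hS₁
  set S₂ : ℝ × ℝ → ℝ := fun p =>
    d.L₂ p.2 * K₂ p - d.γ * (u 2 (p.1, p.1) - u 0 (p.1, p.1)) * d.k₂ p with hS₂
  have eS₁ : EqOn (d.source₁ (u 0) (u 2)) S₁ triangle := fun p hp => by
    simp only [source₁, hS₁, hK₁]
    -- The passage from `u` to `d.picard u` is needed because `V₁` is a potential on the whole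
    -- plane, where only the latter has the transported form.
    rw [d.recover_congr (eP 0) (eP 2) hp, d.recover_of_potential₁ hV₁ (cP 0) (cP 2) _ hp]
    intro x hx
    rw [← eu 2 _ (diag_mem_triangle hx), ← eu 0 _ (diag_mem_triangle hx), diag₁ x hx]
  have eS₂ : EqOn (d.source₂ (u 0) (u 2) (u 1) (u 3)) S₂ triangle := fun p hp => by
    simp only [source₂, hS₂, hK₂]
    rw [d.recover_congr (eP 1) (eP 3) hp, d.recover_of_potential₂ hV₂ (cP 1) (cP 3) _ hp]
    intro x hx
    rw [← eu 3 _ (diag_mem_triangle hx), diag₂ x hx]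
  have eu0 : ∀ p ∈ triangle, u 0 p = u 0 (p.1 - d.a * p.2, 0) + 1 / d.μ * hatInt d.a S₁ p := by
    intro p hp
    rw [eu 0 p hp, eu 0 _ (axis_mem_triangle (hatFoot_mem ha ha1 hp)), picard_zero,
      ← hatInt_congr ha ha1 hp eS₁]
    simp
  have eu1 : ∀ p ∈ triangle, u 1 p = (d.t₂ * u 2 (p.1 - 1 * p.2, 0) + d.q * u 3 (p.1 - 1 * p.2, 0))
      + 1 / d.μ * hatInt 1 S₂ p := by
    intro p hp
    rw [eu 1 p hp, picard_one, ← hatInt_congr one_pos le_rfl hp eS₂]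
  have eu2 : ∀ p ∈ triangle, u 2 p = -d.r * u 0 (diagFoot d.a p, diagFoot d.a p) +
      1 / d.μ * checkInt d.a S₁ p := by
    intro p hp
    rw [eu 2 p hp, picard_two, ← checkInt_congr ha hp eS₁]
  have eu3 : ∀ p ∈ triangle, u 3 p = -(d.L₂ (diagFoot 1 p) / (2 * d.μ)) +
      1 / d.μ * checkInt 1 S₂ p := by
    intro p hp
    rw [eu 3 p hp, picard_three, ← checkInt_congr one_pos hp eS₂]
  have ch₁ := contDiff_hatInt (rS₁ hk₁)
  have cc₁ := contDiff_checkInt (rS₁ hk₁')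
  set v3 : ℝ × ℝ → ℝ := fun p => -(d.L₂ (diagFoot 1 p) / (2 * d.μ)) + 1 / d.μ * checkInt 1 S₂ p
    with hv3
  have cC₃ : ContDiff ℝ 1 fun x => -(d.L₂ x / (2 * d.μ)) := by fun_prop
  have cv3 : ContDiff ℝ 1 v3 := contDiff_check_transport cC₃ (rS₂ hk₂')
  have ev3 : EqOn v3 (u 3) triangle := fun p hp => (eu3 p hp).symm
  set F : ℝ → ℝ := fun x =>
    d.q * d.r * (1 / d.μ * hatInt d.a S₁ (diagFoot d.a (x, 0), diagFoot d.a (x, 0))) -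
      d.q * (1 / d.μ * checkInt d.a S₁ (x, 0)) + d.t₁ * v3 (x, 0) with hF
  have cF : ContDiff ℝ 1 F := by
    have := contDiff_diagFoot (a := d.a) (n := 1)
    fun_prop
  -- One round trip backwards from the axis: up to the diagonal along slope -1 / a, down again along
  -- slope 1 / a. It scales x by (1 - a) / (1 + a) and collects the two reflection coefficients.
  have htrace : ∀ x ∈ Icc (0 : ℝ) 1,
      u 0 (x, 0) = d.q * d.r * u 0 ((1 - d.a) / (1 + d.a) * x, 0) + F x := by
    intro x hx
    have hxT := axis_mem_triangle hx
    have hs := diag_mem_triangle (diagFoot_mem ha hxT)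
    have e0 : u 0 (x, 0) = -d.q * u 2 (x, 0) + d.t₁ * u 3 (x, 0) := by
      rw [eu 0 _ hxT, picard_zero]
      simp
    have e1 : diagFoot d.a (x, 0) - d.a * diagFoot d.a (x, 0) = (1 - d.a) / (1 + d.a) * x := by
      simp only [diagFoot]
      ring
    have e2 := eu0 _ hs
    simp only [e1] at e2
    simp only [hF]
    rw [e0, eu2 _ hxT, e2, ev3 hxT]
    ring
  have hqr : |d.q * d.r| < 1 := by
    rw [abs_of_nonneg (mul_nonneg d.q_nonneg d.r_nonneg)]
    exact mul_lt_one_of_nonneg_of_lt_one_left d.q_nonneg d.q_lt_one d.r_lt_one.le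
  -- The dilation factor coincides with `d.r`, hence the bounds on `d.r` serve for it.
  obtain ⟨G, cG, eG⟩ := exists_contDiff_of_dilation_eq (H := fun x => u 0 (x, 0)) hqr
    d.r_nonneg d.r_lt_one.le cF (by fun_prop) htrace
  set v0 : ℝ × ℝ → ℝ := fun p => G (p.1 - d.a * p.2) + 1 / d.μ * hatInt d.a S₁ p with hv0
  have cv0 : ContDiff ℝ 1 v0 := contDiff_hat_transport cG (rS₁ hk₁)
  have ev0 : EqOn v0 (u 0) triangle := fun p hp => by
    rw [eu0 p hp, hv0]
    simp only [eG (hatFoot_mem ha ha1 hp)]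
  set v2 : ℝ × ℝ → ℝ := fun p => -d.r * v0 (diagFoot d.a p, diagFoot d.a p) +
    1 / d.μ * checkInt d.a S₁ p with hv2
  have cC₂ : ContDiff ℝ 1 fun x => -d.r * v0 (x, x) := by fun_prop
  have cv2 : ContDiff ℝ 1 v2 := contDiff_check_transport cC₂ (rS₁ hk₁')
  have ev2 : EqOn v2 (u 2) triangle := fun p hp => by
    rw [eu2 p hp, hv2]
    simp only [ev0 (diag_mem_triangle (diagFoot_mem ha hp))]
  set v1 : ℝ × ℝ → ℝ := fun p => (d.t₂ * v2 (p.1 - 1 * p.2, 0) + d.q * v3 (p.1 - 1 * p.2, 0)) +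
    1 / d.μ * hatInt 1 S₂ p with hv1
  have cH₁ : ContDiff ℝ 1 fun x => d.t₂ * v2 (x, 0) + d.q * v3 (x, 0) := by fun_prop
  have cv1 : ContDiff ℝ 1 v1 := contDiff_hat_transport cH₁ (rS₂ hk₂)
  have ev1 : EqOn v1 (u 1) triangle := fun p hp => by
    have hf := axis_mem_triangle (hatFoot_mem one_pos le_rfl hp)
    rw [eu1 p hp, hv1]
    simp only [ev2 hf, ev3 hf]
  -- `V₁` and `V₂` belong to the continuous `d.picard u`; the new potentials have the C¹
  -- representatives as gradient data and are therefore C².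
  obtain ⟨W₁, hW₁⟩ := exists_potential (μ := d.μ) (kh := v0) (kc := v2) ha cG.continuous
    cC₂.continuous (rS₁ hk₁).cont (fun _ => rfl) (fun _ => rfl)
  obtain ⟨W₂, hW₂⟩ := exists_potential (μ := d.μ) (kh := v1) (kc := v3) one_pos cH₁.continuous
    cC₃.continuous (rS₂ hk₂).cont (fun _ => rfl) (fun _ => rfl)
  have fS₁ : EqOn S₁ (d.source₁ v0 v2) triangle := fun p hp => by
    rw [← eS₁ hp, d.source₁_congr ev0 ev2 hp]
  have fS₂ : EqOn S₂ (d.source₂ v0 v2 v1 v3) triangle := fun p hp => by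
    rw [← eS₂ hp, d.source₂_congr ev0 ev2 ev1 ev3 hp]
  refine ⟨![v0, v1, v2, v3], W₁, W₂, ?_, ?_, hW₁, hW₂, fun p hp => ⟨?_, ?_, ?_, ?_⟩⟩
  · intro i
    match i with
    | 0 => exact cv0
    | 1 => exact cv1
    | 2 => exact cv2
    | 3 => exact cv3
  · intro i
    match i with
    | 0 => exact ev0
    | 1 => exact ev1
    | 2 => exact ev2
    | 3 => exact ev3
  · exact (fderiv_hat_transport ha cG (rS₁ hk₁) p).trans (by rw [fS₁ hp]; rfl)
  · exact (fderiv_hat_transport one_pos cH₁ (rS₂ hk₂) p).trans (by rw [fS₂ hp]; rfl)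
  · exact (fderiv_check_transport ha cC₂ (rS₁ hk₁') p).trans (by rw [fS₁ hp]; rfl)
  · exact (fderiv_check_transport one_pos cC₃ (rS₂ hk₂') p).trans (by rw [fS₂ hp]; rfl)

end Coefficients

/-! ### Between differential equations and characteristic integrals -/

theorem fderivWithin_triangle_apply (f : ℝ × ℝ → ℝ) (p : ℝ × ℝ) (s t : ℝ) :
    fderivWithin ℝ f triangle p (s, t) = s * dx f p + t * dy f p := by
  have : ((s, t) : ℝ × ℝ) = s • (1, 0) + t • (0, 1) := by simp
  rw [this, map_add, map_smul, map_smul]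
  rfl

/-- A `C¹` function on the triangle with prescribed derivative along a curve in it. -/
theorem integral_along_line {f : ℝ × ℝ → ℝ} (hf : ContDiffOn ℝ 1 f triangle) {c w l x : ℝ}
    (hlx : l ≤ x) (hmem : ∀ z ∈ Icc l x, (z, w + c * z) ∈ triangle) {g : ℝ → ℝ} (hg : Continuous g)
    (hd : ∀ z ∈ Icc l x, dx f (z, w + c * z) + c * dy f (z, w + c * z) = g z) :
    ∫ z in l..x, g z = f (x, w + c * x) - f (l, w + c * l) := by
  refine intervalIntegral.integral_eq_sub_of_hasDerivAt_of_le (f := fun z => f (z, w + c * z)) hlx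
    (hf.continuousOn.comp (by fun_prop) hmem) (fun z hz => ?_) (hg.intervalIntegrable _ _)
  have hz' := Ioo_subset_Icc_self hz
  have h1 := (hf.differentiableOn one_ne_zero _ (hmem z hz')).hasFDerivWithinAt
  have h0 : HasDerivAt (fun z => (z, w + c * z)) (1, c) z := by
    refine (hasDerivAt_id z).prodMk ?_
    simpa using ((hasDerivAt_id z).const_mul c).const_add w
  have h2 := (h1.comp_hasDerivWithinAt z h0.hasDerivWithinAt hmem).hasDerivAt
    (Icc_mem_nhds hz.1 hz.2)
  refine h2.congr_deriv ?_
  rw [fderivWithin_triangle_apply, one_mul, hd z hz']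

theorem eq_hatInt_of_pde {a μ : ℝ} (ha : 0 < a) (ha1 : a ≤ 1) (hμ : 0 < μ) {f S : ℝ × ℝ → ℝ}
    (hf : ContDiffOn ℝ 1 f triangle) (hS : Continuous S)
    (h : ∀ p ∈ triangle, μ * dx f p + μ / a * dy f p = S p) {p : ℝ × ℝ} (hp : p ∈ triangle) :
    f p = f (p.1 - a * p.2, 0) + 1 / μ * hatInt a S p := by
  have e : ∀ z, p.2 - p.1 / a + a⁻¹ * z = p.2 - (p.1 - z) / a := fun z => by ring
  have key := integral_along_line hf (c := a⁻¹) (w := p.2 - p.1 / a) (hatFoot_le ha hp)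
    (fun z hz => by rw [e]; exact hatChar_mem ha ha1 hp hz)
    (g := fun z => 1 / μ * S (z, p.2 - (p.1 - z) / a)) (by fun_prop) (fun z hz => by
      rw [e, ← h _ (hatChar_mem ha ha1 hp hz)]
      field_simp)
  rw [intervalIntegral.integral_const_mul] at key
  have e1 : p.2 - p.1 / a + a⁻¹ * p.1 = p.2 := by ring
  have e2 : p.2 - p.1 / a + a⁻¹ * (p.1 - a * p.2) = 0 := by
    field_simp
    ring
  rw [e1, e2] at key
  rw [hatInt, key]
  ring

theorem eq_checkInt_of_pde {a μ : ℝ} (ha : 0 < a) (hμ : 0 < μ) {f S : ℝ × ℝ → ℝ}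
    (hf : ContDiffOn ℝ 1 f triangle) (hS : Continuous S)
    (h : ∀ p ∈ triangle, μ * dx f p - μ / a * dy f p = S p) {p : ℝ × ℝ} (hp : p ∈ triangle) :
    f p = f (diagFoot a p, diagFoot a p) + 1 / μ * checkInt a S p := by
  have e : ∀ z, p.2 + p.1 / a + -a⁻¹ * z = p.2 + (p.1 - z) / a := fun z => by ring
  have key := integral_along_line hf (c := -a⁻¹) (w := p.2 + p.1 / a) (diagFoot_le ha hp)
    (fun z hz => by rw [e]; exact checkChar_mem ha hp hz)
    (g := fun z => 1 / μ * S (z, p.2 + (p.1 - z) / a)) (by fun_prop) (fun z hz => by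
      rw [e, ← h _ (checkChar_mem ha hp hz)]
      field_simp
      ring)
  rw [intervalIntegral.integral_const_mul] at key
  have e1 : p.2 + p.1 / a + -a⁻¹ * p.1 = p.2 := by ring
  have e2 : p.2 + p.1 / a + -a⁻¹ * diagFoot a p = diagFoot a p := by
    have : 1 + a ≠ 0 := by positivity
    simp only [diagFoot]
    field_simp
    ring
  rw [e1, e2] at key
  rw [checkInt, key]
  ring

theorem dx_eq_fderiv {f : ℝ × ℝ → ℝ} (hf : ContDiff ℝ 1 f) {p : ℝ × ℝ} (hp : p ∈ triangle) :
    dx f p = fderiv ℝ f p (1, 0) := by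
  rw [dx, fderivWithin_eq_fderiv (uniqueDiffOn_triangle p hp) (hf.differentiable one_ne_zero p)]

theorem dy_eq_fderiv {f : ℝ × ℝ → ℝ} (hf : ContDiff ℝ 1 f) {p : ℝ × ℝ} (hp : p ∈ triangle) :
    dy f p = fderiv ℝ f p (0, 1) := by
  rw [dy, fderivWithin_eq_fderiv (uniqueDiffOn_triangle p hp) (hf.differentiable one_ne_zero p)]

theorem pde_of_fderiv_char {a μ s : ℝ} (ha : 0 < a) (hμ : 0 < μ) {f S : ℝ × ℝ → ℝ}
    (hf : ContDiff ℝ 1 f) {p : ℝ × ℝ} (hp : p ∈ triangle)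
    (h : fderiv ℝ f p (a, s) = 1 / μ * (a * S p)) : μ * dx f p + μ / a * (s * dy f p) = S p := by
  have e : ((a, s) : ℝ × ℝ) = a • (1, 0) + s • (0, 1) := by simp
  rw [e, map_add, map_smul, map_smul, ← dx_eq_fderiv hf hp, ← dy_eq_fderiv hf hp, smul_eq_mul,
    smul_eq_mul] at h
  have : μ * dx f p + μ / a * (s * dy f p) = μ / a * (a * dx f p + s * dy f p) := by field_simp
  rw [this, h]
  field_simp

section Kernel

variable {a μ : ℝ} {W kh kc K : ℝ × ℝ → ℝ}

theorem contDiffOn_of_eqOn_potential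
    (hW : ∀ p, HasFDerivAt W (planeForm (kh p + kc p) (a * (kc p - kh p))) p)
    (ch : ContDiff ℝ 1 kh) (cc : ContDiff ℝ 1 kc)
    (hK : ∀ p ∈ triangle, K p = 1 / (2 * μ) * (W p - W (0, 0))) : ContDiffOn ℝ 2 K triangle := by
  have := contDiff_two_of_potential hW ch cc
  exact ContDiffOn.congr (f := fun p => 1 / (2 * μ) * (W p - W (0, 0)))
    (ContDiff.contDiffOn (by fun_prop)) hK

/-- The gradient of `W` determines the derivatives of `K`, since the triangle has unique derivatives
up to its boundary; kh and kc then solve a 2 × 2 linear system. -/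
theorem invariants_of_eqOn_potential (ha : 0 < a) (hμ : 0 < μ)
    (hW : ∀ p, HasFDerivAt W (planeForm (kh p + kc p) (a * (kc p - kh p))) p)
    (hK : ∀ p ∈ triangle, K p = 1 / (2 * μ) * (W p - W (0, 0))) {p : ℝ × ℝ} (hp : p ∈ triangle) :
    kh p = μ * dx K p - μ / a * dy K p ∧ kc p = μ * dx K p + μ / a * dy K p := by
  have h1 : HasFDerivWithinAt K (((1 / (2 * μ)) : ℝ) •
      planeForm (kh p + kc p) (a * (kc p - kh p))) triangle p :=
    (((hW p).sub_const (W (0, 0))).const_mul (1 / (2 * μ))).hasFDerivWithinAt.congr hK (hK p hp)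
  have h2 := h1.fderivWithin (uniqueDiffOn_triangle p hp)
  have ex : dx K p = 1 / (2 * μ) * (kh p + kc p) := by
    rw [dx, h2]
    simp
  have ey : dy K p = 1 / (2 * μ) * (a * (kc p - kh p)) := by
    rw [dy, h2]
    simp
  rw [ex, ey]
  constructor
  · field_simp
    ring
  · field_simp
    ring

end Kernel

/-! ### The physical parameters in terms of the folding ratio -/

section Parameters

variable {ε y₀ : ℝ}

theorem sqrt_eps1 (hy₀ : -1 < y₀) : √(eps1 ε y₀) = √ε / (1 + y₀) := by
  rw [eps1, Real.sqrt_div' _ (sq_nonneg _), Real.sqrt_sq (by linarith)]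

theorem sqrt_eps2 (hy₀' : y₀ ≤ 0) : √(eps2 ε y₀) = √ε / (1 - y₀) := by
  rw [eps2, Real.sqrt_div' _ (sq_nonneg _), Real.sqrt_sq (by linarith)]

theorem sqrt_eps2_pos (hε : 0 < ε) (hy₀' : y₀ ≤ 0) : 0 < √(eps2 ε y₀) := by
  rw [sqrt_eps2 hy₀']
  exact div_pos (Real.sqrt_pos.2 hε) (by linarith)

theorem foldRatio_pos (hy₀ : -1 < y₀) (hy₀' : y₀ ≤ 0) : 0 < foldRatio y₀ :=
  div_pos (by linarith) (by linarith)

theorem foldRatio_le_one (hy₀' : y₀ ≤ 0) : foldRatio y₀ ≤ 1 := by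
  rw [foldRatio, div_le_one (by linarith)]
  linarith

theorem sqrt_eps1_eq (hy₀ : -1 < y₀) (hy₀' : y₀ ≤ 0) :
    √(eps1 ε y₀) = √(eps2 ε y₀) / foldRatio y₀ := by
  have h1 : 1 + y₀ ≠ 0 := by linarith
  have h2 : 1 - y₀ ≠ 0 := by linarith
  rw [sqrt_eps1 hy₀, sqrt_eps2 hy₀', foldRatio]
  field_simp

theorem lowerPart_eq (hε : 0 < ε) (hy₀ : -1 < y₀) (hy₀' : y₀ ≤ 0) :
    lowerPart ε y₀ = {p ∈ triangle | p.2 ≤ foldRatio y₀ * p.1} := by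
  have ha := foldRatio_pos hy₀ hy₀'
  have hμ := sqrt_eps2_pos hε hy₀'
  ext p
  simp only [lowerPart, mem_ofPred_eq, sqrt_eps1_eq (ε := ε) hy₀ hy₀']
  rw [div_mul_eq_mul_div, div_le_iff₀ ha, mul_assoc, mul_le_mul_iff_right₀ hμ, mul_comm p.1]

theorem upperPart_eq (hε : 0 < ε) (hy₀ : -1 < y₀) (hy₀' : y₀ ≤ 0) :
    upperPart ε y₀ = {p ∈ triangle | foldRatio y₀ * p.1 ≤ p.2} := by
  have ha := foldRatio_pos hy₀ hy₀'
  have hμ := sqrt_eps2_pos hε hy₀'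
  ext p
  simp only [upperPart, mem_ofPred_eq, sqrt_eps1_eq (ε := ε) hy₀ hy₀']
  rw [div_mul_eq_mul_div, le_div_iff₀ ha, mul_assoc, mul_le_mul_iff_right₀ hμ, mul_comm p.1]

/-- A source which is `C¹` on both sides of the separating ray extends to a function regular along
the characteristics of slope `1` and `-1`. -/
theorem exists_regular_extension_of_parts (hε : 0 < ε) (hy₀ : -1 < y₀) (hy₀' : y₀ ≤ 0)
    {k : ℝ × ℝ → ℝ} (hl : ContDiffOn ℝ 1 k (lowerPart ε y₀))
    (hu : ContDiffOn ℝ 1 k (upperPart ε y₀)) :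
    ∃ g gy : ℝ × ℝ → ℝ, EqOn g k triangle ∧ RegularAlong 1⁻¹ g gy ∧ RegularAlong (-1⁻¹) g gy := by
  have ha := foldRatio_pos hy₀ hy₀'
  rw [lowerPart_eq hε hy₀ hy₀'] at hl
  rw [upperPart_eq hε hy₀ hy₀'] at hu
  -- For ratio 1 the ray is the diagonal, along which slope 1 is not transversal; but the lower part
  -- is then the whole triangle and no kink is present.
  rcases (foldRatio_le_one hy₀').lt_or_eq with h1 | h1
  · have sl : sector 0 (foldRatio y₀) ⊆ {p ∈ triangle | p.2 ≤ foldRatio y₀ * p.1} := by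
      rintro p ⟨hx, h2, h3⟩
      exact ⟨⟨by linarith, h3.trans (mul_le_of_le_one_left hx.1 h1.le), hx.2⟩, h3⟩
    have su : sector (foldRatio y₀) 1 ⊆ {p ∈ triangle | foldRatio y₀ * p.1 ≤ p.2} := by
      rintro p ⟨hx, h2, h3⟩
      exact ⟨⟨(mul_nonneg ha.le hx.1).trans h2, by linarith, hx.2⟩, h2⟩
    obtain ⟨g, gy, h, hr⟩ := exists_piecewise_regular_extension ha h1 (hl.mono sl) (hu.mono su)
    refine ⟨g, gy, h, hr _ (by rw [inv_one]; exact h1.ne'), hr _ ?_⟩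
    rw [inv_one]
    linarith
  · obtain ⟨g, gy, h, hr⟩ := exists_regular_extension
      (hl.mono fun p hp => ⟨hp, by rw [h1, one_mul]; exact hp.2.1⟩)
    exact ⟨g, gy, h, hr _, hr _⟩

end Parameters

/-! ### Existence and uniqueness for the kernel system -/

/-- `d` consists of the coefficients of the kernel system, extended off the triangle. -/
structure Coefficients.Extends (d : Coefficients) (ε y₀ c₂ : ℝ) (lam₁ lam₂ : ℝ → ℝ)
    (k₁₁ k₁₂ : ℝ × ℝ → ℝ) : Prop where
  a_eq : foldRatio y₀ = d.a
  μ_eq : √(eps2 ε y₀) = d.μ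
  sqrt_eps1 : √(eps1 ε y₀) = d.μ / d.a
  eps2_eq : eps2 ε y₀ = d.μ ^ 2
  γ_eq : (eps2 ε y₀ - eps1 ε y₀) / (2 * √(eps1 ε y₀)) = d.γ
  L₁_eq : ∀ y ∈ Icc (0 : ℝ) 1, d.L₁ y = lam₁ y + c₂
  L₂_eq : ∀ y ∈ Icc (0 : ℝ) 1, d.L₂ y = lam₂ y + c₂
  k₁_eq : EqOn d.k₁ k₁₁ triangle
  k₂_eq : EqOn d.k₂ k₁₂ triangle

namespace Coefficients.Extends

variable {d : Coefficients} {ε y₀ c₂ : ℝ} {lam₁ lam₂ : ℝ → ℝ} {k₁₁ k₁₂ : ℝ × ℝ → ℝ}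

theorem k21Of_eq (h : d.Extends ε y₀ c₂ lam₁ lam₂ k₁₁ k₁₂) (kh kc : ℝ × ℝ → ℝ) : k21Of ε y₀ kh kc = d.recover kh kc := by
  funext p
  rw [k21Of, h.μ_eq, recover]

theorem k22Of_eq (h : d.Extends ε y₀ c₂ lam₁ lam₂ k₁₁ k₁₂) (kh kc : ℝ × ℝ → ℝ) {p : ℝ × ℝ} (hp : p ∈ triangle) :
    k22Of ε y₀ c₂ lam₂ kh kc p =
      -(∫ z in (0 : ℝ)..p.2, d.L₂ z / (2 * d.μ ^ 2)) + d.recover kh kc p := by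
  rw [k22Of, h.μ_eq, h.eps2_eq, recover]
  congr 2
  refine intervalIntegral.integral_congr fun z hz => ?_
  rw [uIcc_of_le hp.1] at hz
  simp only [h.L₂_eq z ⟨hz.1, hz.2.trans (hp.2.1.trans hp.2.2)⟩]

theorem source₁_eq (h : d.Extends ε y₀ c₂ lam₁ lam₂ k₁₁ k₁₂) (kh kc : ℝ × ℝ → ℝ) {p : ℝ × ℝ} (hp : p ∈ triangle) :
    (lam₁ p.2 + c₂) * k21Of ε y₀ kh kc p - gTrace ε y₀ kh kc p.1 * k₁₁ p = d.source₁ kh kc p := by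
  rw [source₁, gTrace, h.γ_eq, h.k21Of_eq, h.L₁_eq _ ⟨hp.1, hp.2.1.trans hp.2.2⟩, h.k₁_eq hp]

theorem source₂_eq (h : d.Extends ε y₀ c₂ lam₁ lam₂ k₁₁ k₁₂) (kh kc lh lc : ℝ × ℝ → ℝ) {p : ℝ × ℝ} (hp : p ∈ triangle) :
    (lam₂ p.2 + c₂) * k22Of ε y₀ c₂ lam₂ lh lc p - gTrace ε y₀ kh kc p.1 * k₁₂ p =
      d.source₂ kh kc lh lc p := by
  rw [source₂, gTrace, h.γ_eq, h.k22Of_eq _ _ hp, h.L₂_eq _ ⟨hp.1, hp.2.1.trans hp.2.2⟩,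
    h.k₂_eq hp]

theorem r_eq (h : d.Extends ε y₀ c₂ lam₁ lam₂ k₁₁ k₁₂) :
    (√(eps1 ε y₀) - √(eps2 ε y₀)) / (√(eps1 ε y₀) + √(eps2 ε y₀)) = d.r := by
  have ha := d.a_pos
  have hμ := d.μ_pos
  have h1 : d.μ / d.a - d.μ = d.μ / d.a * (1 - d.a) := by field_simp
  have h2 : d.μ / d.a + d.μ = d.μ / d.a * (1 + d.a) := by field_simp
  rw [h.sqrt_eps1, h.μ_eq, r, h1, h2, mul_div_mul_left _ _ (by positivity)]

/-- Every classical solution is a fixed point of the integration along characteristics. -/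
theorem exists_fixedPoint_of_solution (h : d.Extends ε y₀ c₂ lam₁ lam₂ k₁₁ k₁₂) {kh₁ kh₂ kc₁ kc₂ : ℝ × ℝ → ℝ}
    (hs : IsSecondRowSolution ε y₀ c₂ lam₁ lam₂ k₁₁ k₁₂ kh₁ kh₂ kc₁ kc₂) :
    ∃ u : Fin 4 → ℝ × ℝ → ℝ, (∀ i, Continuous (u i)) ∧
      (∀ i, ∀ p ∈ triangle, u i p = d.picard u i p) ∧ EqOn (u 0) kh₁ triangle ∧
      EqOn (u 1) kh₂ triangle ∧ EqOn (u 2) kc₁ triangle ∧ EqOn (u 3) kc₂ triangle := by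
  have ha := d.a_pos
  have ha1 := d.a_le_one
  have hμ := d.μ_pos
  have ext : ∀ {f : ℝ × ℝ → ℝ}, ContDiffOn ℝ 1 f triangle →
      Continuous (fun p => f (sectorRetract 0 1 p)) ∧
      EqOn (fun p => f (sectorRetract 0 1 p)) f triangle := by
    intro f hf
    refine ⟨hf.continuousOn.comp_continuous (continuous_sectorRetract 0 1) fun p => ?_,
      fun p hp => ?_⟩
    · rw [triangle_eq_sector]
      exact sectorRetract_mem zero_le_one p
    · rw [triangle_eq_sector] at hp
      simp only [sectorRetract_of_mem hp]
  obtain ⟨c0, e0⟩ := ext hs.contDiff_kh₂₁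
  obtain ⟨c1, e1⟩ := ext hs.contDiff_kh₂₂
  obtain ⟨c2, e2⟩ := ext hs.contDiff_kc₂₁
  obtain ⟨c3, e3⟩ := ext hs.contDiff_kc₂₂
  set u0 : ℝ × ℝ → ℝ := fun p => kh₁ (sectorRetract 0 1 p)
  set u1 : ℝ × ℝ → ℝ := fun p => kh₂ (sectorRetract 0 1 p)
  set u2 : ℝ × ℝ → ℝ := fun p => kc₁ (sectorRetract 0 1 p)
  set u3 : ℝ × ℝ → ℝ := fun p => kc₂ (sectorRetract 0 1 p)
  have s₁ := fun {p : ℝ × ℝ} (hp : p ∈ triangle) =>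
    (h.source₁_eq kh₁ kc₁ hp).trans (d.source₁_congr e0 e2 hp).symm
  have s₂ := fun {p : ℝ × ℝ} (hp : p ∈ triangle) =>
    (h.source₂_eq kh₁ kc₁ kh₂ kc₂ hp).trans (d.source₂_congr e0 e2 e1 e3 hp).symm
  have cs₁ := d.continuous_source₁ c0 c2
  have cs₂ := d.continuous_source₂ c0 c2 c1 c3
  have p0 := hs.pde_kh₂₁
  have p1 := hs.pde_kh₂₂
  have p2 := hs.pde_kc₂₁
  have p3 := hs.pde_kc₂₂
  have b0 := hs.bc_kh₂₁
  have b1 := hs.bc_kh₂₂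
  have b2 := hs.bc_kc₂₁
  have b3 := hs.bc_kc₂₂
  simp only [h.μ_eq, h.sqrt_eps1, h.a_eq] at p0 p1 p2 p3 b0 b1 b3
  rw [h.r_eq] at b2
  refine ⟨![u0, u1, u2, u3], ?_, ?_, e0, e1, e2, e3⟩
  · intro i
    match i with
    | 0 => exact c0
    | 1 => exact c1
    | 2 => exact c2
    | 3 => exact c3
  · intro i p hp
    match i with
    | 0 =>
      have hx := hatFoot_mem ha ha1 hp
      have hf := axis_mem_triangle hx
      rw [picard_zero]
      change u0 p = (-d.q * u2 (p.1 - d.a * p.2, 0) + d.t₁ * u3 (p.1 - d.a * p.2, 0)) +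
        1 / d.μ * hatInt d.a (d.source₁ u0 u2) p
      rw [e0 hp, e2 hf, e3 hf, eq_hatInt_of_pde ha ha1 hμ hs.contDiff_kh₂₁ cs₁
        (fun q hq => (p0 q hq).trans (s₁ hq)) hp, b0 _ hx]
      rfl
    | 1 =>
      have hx := hatFoot_mem one_pos le_rfl hp
      have hf := axis_mem_triangle hx
      rw [picard_one]
      change u1 p = (d.t₂ * u2 (p.1 - 1 * p.2, 0) + d.q * u3 (p.1 - 1 * p.2, 0)) +
        1 / d.μ * hatInt 1 (d.source₂ u0 u2 u1 u3) p
      rw [e1 hp, e2 hf, e3 hf, eq_hatInt_of_pde one_pos le_rfl hμ hs.contDiff_kh₂₂ cs₂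
        (fun q hq => by rw [div_one]; exact (p1 q hq).trans (s₂ hq)) hp, b1 _ hx]
      rfl
    | 2 =>
      have hx := diagFoot_mem ha hp
      have hf := diag_mem_triangle hx
      rw [picard_two]
      change u2 p = -d.r * u0 (diagFoot d.a p, diagFoot d.a p) +
        1 / d.μ * checkInt d.a (d.source₁ u0 u2) p
      rw [e2 hp, e0 hf, eq_checkInt_of_pde ha hμ hs.contDiff_kc₂₁ cs₁
        (fun q hq => (p2 q hq).trans (s₁ hq)) hp, b2 _ hx]
    | 3 =>
      have hx := diagFoot_mem one_pos hp
      rw [picard_three]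
      change u3 p = -(d.L₂ (diagFoot 1 p) / (2 * d.μ)) +
        1 / d.μ * checkInt 1 (d.source₂ u0 u2 u1 u3) p
      rw [e3 hp, h.L₂_eq _ hx, eq_checkInt_of_pde one_pos hμ hs.contDiff_kc₂₂ cs₂
        (fun q hq => by rw [div_one]; exact (p3 q hq).trans (s₂ hq)) hp, b3 _ hx]

/-- Two classical solutions agree on the triangle. -/
theorem solution_unique (h : d.Extends ε y₀ c₂ lam₁ lam₂ k₁₁ k₁₂) {kh₁ kh₂ kc₁ kc₂ lh₁ lh₂ lc₁ lc₂ : ℝ × ℝ → ℝ}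
    (hk : IsSecondRowSolution ε y₀ c₂ lam₁ lam₂ k₁₁ k₁₂ kh₁ kh₂ kc₁ kc₂)
    (hl : IsSecondRowSolution ε y₀ c₂ lam₁ lam₂ k₁₁ k₁₂ lh₁ lh₂ lc₁ lc₂) :
    EqOn lh₁ kh₁ triangle ∧ EqOn lh₂ kh₂ triangle ∧ EqOn lc₁ kc₁ triangle ∧
      EqOn lc₂ kc₂ triangle := by
  obtain ⟨u, cu, fu, u0, u1, u2, u3⟩ := h.exists_fixedPoint_of_solution hk
  obtain ⟨v, cv, fv, v0, v1, v2, v3⟩ := h.exists_fixedPoint_of_solution hl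
  have e := d.picard_fixedPoint_unique cv cu fv fu
  exact ⟨v0.symm.trans ((e 0).trans u0), v1.symm.trans ((e 1).trans u1),
    v2.symm.trans ((e 2).trans u2), v3.symm.trans ((e 3).trans u3)⟩

end Coefficients.Extends

theorem Coefficients.Extends.exists_solution {d : Coefficients} {ε y₀ c₂ : ℝ} {lam₁ lam₂ : ℝ → ℝ}
    {k₁₁ k₁₂ : ℝ × ℝ → ℝ} (h : d.Extends ε y₀ c₂ lam₁ lam₂ k₁₁ k₁₂) (hL₁ : ContDiff ℝ 1 d.L₁)
    (hL₂ : ContDiff ℝ 1 d.L₂) {k₁y k₂y : ℝ × ℝ → ℝ} (hk₁ : RegularAlong d.a⁻¹ d.k₁ k₁y)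
    (hk₁' : RegularAlong (-d.a⁻¹) d.k₁ k₁y) (hk₂ : RegularAlong 1⁻¹ d.k₂ k₂y)
    (hk₂' : RegularAlong (-1⁻¹) d.k₂ k₂y) :
    ∃ kh₁ kh₂ kc₁ kc₂ W₁ W₂ : ℝ × ℝ → ℝ,
      IsSecondRowSolution ε y₀ c₂ lam₁ lam₂ k₁₁ k₁₂ kh₁ kh₂ kc₁ kc₂ ∧
      (ContDiff ℝ 1 kh₁ ∧ ContDiff ℝ 1 kh₂ ∧ ContDiff ℝ 1 kc₁ ∧ ContDiff ℝ 1 kc₂) ∧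
      (∀ p, HasFDerivAt W₁ (planeForm (kh₁ p + kc₁ p) (d.a * (kc₁ p - kh₁ p))) p) ∧
      (∀ p, HasFDerivAt W₂ (planeForm (kh₂ p + kc₂ p) (1 * (kc₂ p - kh₂ p))) p) ∧
      (∀ p ∈ triangle, k21Of ε y₀ kh₁ kc₁ p = 1 / (2 * d.μ) * (W₁ p - W₁ (0, 0))) ∧
      ∀ p ∈ triangle, k22Of ε y₀ c₂ lam₂ kh₂ kc₂ p = 1 / (2 * d.μ) * (W₂ p - W₂ (0, 0)) := by
  have ha := d.a_pos
  have hμ := d.μ_pos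
  obtain ⟨u, cu, fu⟩ := d.exists_picard_fixedPoint
  obtain ⟨v, W₁, W₂, cv, ev, hW₁, hW₂, hd⟩ :=
    d.exists_contDiff_of_picard_fixedPoint hL₁ hL₂ hk₁ hk₁' hk₂ hk₂' cu fu
  have b0 : ∀ x ∈ Icc (0 : ℝ) 1, v 0 (x, 0) = -d.q * v 2 (x, 0) + d.t₁ * v 3 (x, 0) := by
    intro x hx
    have hm := axis_mem_triangle hx
    rw [ev 0 hm, ev 2 hm, ev 3 hm, fu 0 _ hm, picard_zero]
    simp
  have b1 : ∀ x ∈ Icc (0 : ℝ) 1, v 1 (x, 0) = d.t₂ * v 2 (x, 0) + d.q * v 3 (x, 0) := by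
    intro x hx
    have hm := axis_mem_triangle hx
    rw [ev 1 hm, ev 2 hm, ev 3 hm, fu 1 _ hm, picard_one]
    simp
  have b2 : ∀ x ∈ Icc (0 : ℝ) 1, v 2 (x, x) = -d.r * v 0 (x, x) := by
    intro x hx
    have hm := diag_mem_triangle hx
    rw [ev 2 hm, ev 0 hm, fu 2 _ hm, picard_two]
    simp [checkInt_diag ha, diagFoot_diag ha]
  have b3 : ∀ x ∈ Icc (0 : ℝ) 1, v 3 (x, x) = -(d.L₂ x / (2 * d.μ)) := by
    intro x hx
    have hm := diag_mem_triangle hx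
    rw [ev 3 hm, fu 3 _ hm, picard_three]
    simp [checkInt_diag one_pos, diagFoot_diag one_pos]
  refine ⟨v 0, v 1, v 2, v 3, W₁, W₂, ⟨(cv 0).contDiffOn, (cv 1).contDiffOn, (cv 2).contDiffOn,
    (cv 3).contDiffOn, fun p hp => ?_, fun p hp => ?_, fun p hp => ?_, fun p hp => ?_, ?_, ?_, ?_,
    ?_⟩, ⟨cv 0, cv 1, cv 2, cv 3⟩, hW₁, hW₂, fun p hp => ?_, fun p hp => ?_⟩
  · rw [h.source₁_eq _ _ hp, h.μ_eq, h.sqrt_eps1, ← one_mul (dy (v 0) p)]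
    exact pde_of_fderiv_char ha hμ (cv 0) hp (hd p hp).1
  · rw [h.source₂_eq _ _ _ _ hp, h.μ_eq]
    simpa only [div_one, one_mul] using
      pde_of_fderiv_char one_pos hμ (cv 1) hp (hd p hp).2.1
  · rw [h.source₁_eq _ _ hp, h.μ_eq, h.sqrt_eps1, sub_eq_add_neg, ← mul_neg,
      ← neg_one_mul (dy (v 2) p)]
    exact pde_of_fderiv_char ha hμ (cv 2) hp (hd p hp).2.2.1
  · rw [h.source₂_eq _ _ _ _ hp, h.μ_eq, sub_eq_add_neg, ← mul_neg, ← neg_one_mul (dy (v 3) p)]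
    simpa only [div_one, one_mul] using
      pde_of_fderiv_char one_pos hμ (cv 3) hp (hd p hp).2.2.2
  · rw [h.a_eq]
    exact b0
  · rw [h.a_eq]
    exact b1
  · rw [h.r_eq]
    exact b2
  · intro x hx
    rw [b3 x hx, h.L₂_eq x hx, h.μ_eq]
  · rw [h.k21Of_eq]
    exact d.recover_of_potential₁ hW₁ (cv 0).continuous (cv 2).continuous b2 hp
  · rw [h.k22Of_eq _ _ hp]
    exact d.recover_of_potential₂ hW₂ (cv 1).continuous (cv 3).continuous b3 hp

end FoldedKernel

end

theorem lemma5 (ε y₀ c₂ : ℝ) (hε : 0 < ε) (hy₀ : -1 < y₀) (hy₀' : y₀ ≤ 0) (hc₂ : 0 < c₂)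
    (lam₁ lam₂ : ℝ → ℝ) (hlam₁ : ContDiffOn ℝ 1 lam₁ (Icc 0 1))
    (hlam₂ : ContDiffOn ℝ 1 lam₂ (Icc 0 1))
    (k₁₁ k₁₂ : ℝ × ℝ → ℝ)
    (hk₁₁ : ContDiffOn ℝ 1 k₁₁ FoldedKernel.triangle)
    (hk₁₂ : ContinuousOn k₁₂ FoldedKernel.triangle)
    (hk₁₂_lower : ContDiffOn ℝ 1 k₁₂ (FoldedKernel.lowerPart ε y₀))
    (hk₁₂_upper : ContDiffOn ℝ 1 k₁₂ (FoldedKernel.upperPart ε y₀)) :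
    ∃ kh₂₁ kh₂₂ kc₂₁ kc₂₂ : ℝ × ℝ → ℝ,
      FoldedKernel.IsSecondRowSolution ε y₀ c₂ lam₁ lam₂ k₁₁ k₁₂ kh₂₁ kh₂₂ kc₂₁ kc₂₂ ∧
      (∀ lh₂₁ lh₂₂ lc₂₁ lc₂₂ : ℝ × ℝ → ℝ,
        FoldedKernel.IsSecondRowSolution ε y₀ c₂ lam₁ lam₂ k₁₁ k₁₂ lh₂₁ lh₂₂ lc₂₁ lc₂₂ →
          EqOn lh₂₁ kh₂₁ FoldedKernel.triangle ∧ EqOn lh₂₂ kh₂₂ FoldedKernel.triangle ∧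
          EqOn lc₂₁ kc₂₁ FoldedKernel.triangle ∧ EqOn lc₂₂ kc₂₂ FoldedKernel.triangle) ∧
      ContDiffOn ℝ 2 (FoldedKernel.k21Of ε y₀ kh₂₁ kc₂₁) FoldedKernel.triangle ∧
      ContDiffOn ℝ 2 (FoldedKernel.k22Of ε y₀ c₂ lam₂ kh₂₂ kc₂₂) FoldedKernel.triangle ∧
      (∀ p ∈ FoldedKernel.triangle,
        kh₂₁ p = √(FoldedKernel.eps2 ε y₀) *
            FoldedKernel.dx (FoldedKernel.k21Of ε y₀ kh₂₁ kc₂₁) p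
          - √(FoldedKernel.eps1 ε y₀) *
            FoldedKernel.dy (FoldedKernel.k21Of ε y₀ kh₂₁ kc₂₁) p ∧
        kc₂₁ p = √(FoldedKernel.eps2 ε y₀) *
            FoldedKernel.dx (FoldedKernel.k21Of ε y₀ kh₂₁ kc₂₁) p
          + √(FoldedKernel.eps1 ε y₀) *
            FoldedKernel.dy (FoldedKernel.k21Of ε y₀ kh₂₁ kc₂₁) p ∧
        kh₂₂ p = √(FoldedKernel.eps2 ε y₀) *
            FoldedKernel.dx (FoldedKernel.k22Of ε y₀ c₂ lam₂ kh₂₂ kc₂₂) p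
          - √(FoldedKernel.eps2 ε y₀) *
            FoldedKernel.dy (FoldedKernel.k22Of ε y₀ c₂ lam₂ kh₂₂ kc₂₂) p ∧
        kc₂₂ p = √(FoldedKernel.eps2 ε y₀) *
            FoldedKernel.dx (FoldedKernel.k22Of ε y₀ c₂ lam₂ kh₂₂ kc₂₂) p
          + √(FoldedKernel.eps2 ε y₀) *
            FoldedKernel.dy (FoldedKernel.k22Of ε y₀ c₂ lam₂ kh₂₂ kc₂₂) p) := by
  obtain ⟨l₁, hl₁, el₁⟩ := FoldedKernel.exists_contDiff_extension hlam₁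
  obtain ⟨l₂, hl₂, el₂⟩ := FoldedKernel.exists_contDiff_extension hlam₂
  obtain ⟨g₁, g₁y, e₁, r₁⟩ := FoldedKernel.exists_regular_extension hk₁₁
  obtain ⟨g₂, g₂y, e₂, r₂, r₂'⟩ :=
    FoldedKernel.exists_regular_extension_of_parts hε hy₀ hy₀' hk₁₂_lower hk₁₂_upper
  have ha := FoldedKernel.foldRatio_pos hy₀ hy₀'
  have hμ := FoldedKernel.sqrt_eps2_pos hε hy₀'
  have hs1 := FoldedKernel.sqrt_eps1_eq (ε := ε) hy₀ hy₀'
  have hL₁ : ContDiff ℝ 1 fun y => l₁ y + c₂ := hl₁.add contDiff_const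
  have hL₂ : ContDiff ℝ 1 fun y => l₂ y + c₂ := hl₂.add contDiff_const
  let d : FoldedKernel.Coefficients :=
    { a := FoldedKernel.foldRatio y₀
      μ := √(FoldedKernel.eps2 ε y₀)
      γ := (FoldedKernel.eps2 ε y₀ - FoldedKernel.eps1 ε y₀) / (2 * √(FoldedKernel.eps1 ε y₀))
      L₁ := fun y => l₁ y + c₂
      L₂ := fun y => l₂ y + c₂
      k₁ := g₁
      k₂ := g₂
      a_pos := ha
      a_le_one := FoldedKernel.foldRatio_le_one hy₀'
      μ_pos := hμ
      cont_L₁ := hL₁.continuous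
      cont_L₂ := hL₂.continuous
      cont_k₁ := (r₁ 0).cont
      cont_k₂ := r₂.cont }
  have hd : d.Extends ε y₀ c₂ lam₁ lam₂ k₁₁ k₁₂ :=
    { a_eq := rfl
      μ_eq := rfl
      sqrt_eps1 := hs1
      eps2_eq := (Real.sq_sqrt (Real.sqrt_pos.1 hμ).le).symm
      γ_eq := rfl
      L₁_eq := fun y hy => congrArg (· + c₂) (el₁ hy)
      L₂_eq := fun y hy => congrArg (· + c₂) (el₂ hy)
      k₁_eq := e₁
      k₂_eq := e₂ }
  obtain ⟨kh₁, kh₂, kc₁, kc₂, W₁, W₂, hsol, ⟨c0, c1, c2, c3⟩, hW₁, hW₂, hK₁, hK₂⟩ :=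
    hd.exists_solution hL₁ hL₂ (r₁ _) (r₁ _) r₂ r₂'
  refine ⟨kh₁, kh₂, kc₁, kc₂, hsol, fun lh₁ lh₂ lc₁ lc₂ hl => hd.solution_unique hsol hl,
    FoldedKernel.contDiffOn_of_eqOn_potential hW₁ c0 c2 hK₁,
    FoldedKernel.contDiffOn_of_eqOn_potential hW₂ c1 c3 hK₂, fun p hp => ?_⟩
  have i₁ := FoldedKernel.invariants_of_eqOn_potential d.a_pos d.μ_pos hW₁ hK₁ hp
  have i₂ := FoldedKernel.invariants_of_eqOn_potential one_pos d.μ_pos hW₂ hK₂ hp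
  rw [div_one] at i₂
  rw [hs1]
  exact ⟨i₁.1, i₁.2, i₂.1, i₂.2⟩
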